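/- Let $n\ge 0$, let $\Sigma$ be a symmetric positive definite $n\times n$ matrix and let $\mu$ be the Gaussian probability measure on $\mathbb R^n$ with mean $0$ and covariance $\Sigma$. Let $\mathrm{Diff}(\mathbb R^n)$ be the group of all $C^\infty$ diffeomorphisms of $\mathbb R^n$, and equip $\mathrm{Diff}(\mathbb R^n)\times\mathbb R_+$ with the natural UOT (conical $L^2$) metric $$\mathcal G_{(\varphi,m)}\big((\dot\varphi,\dot m),(\dot\varphi,\dot m)\big)=m\int_{\mathbb R^n}|\dot\varphi|^2\,d\mu+\frac{\dot m^2}{m}.$$ A family $u\mapsto(\varphi_u,m_u)$ in $\mathrm{Diff}(\mathbb R^n)\times\mathbb R_+$ (with $u$ in a finite-dimensional domain) is called smooth if $(u,x)\mapsto\varphi_u(x)$ and $u\mapsto m_u$ are $C^\infty$ and, for some fixed diffeomorphism $\varphi_0$, $u\mapsto\varphi_u-\varphi_0$ is a $C^\infty$ map into $L^2(\mu;\mathbb R^n)$. For a subset $N\subseteq\mathrm{Diff}(\mathbb R^n)\times\mathbb R_+$, a geodesic of $N$ on an open interval $J$ is a smooth curve $\gamma\colon J\to N$ which, on each $[a,b]\subset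 J$, is a critical point of the energy $\frac12\int_a^b\mathcal G(\dot\gamma,\dot\gamma)\,dt$ with respect to smooth variations through curves in $N$ with fixed ends; $T_pN$ is the set of velocities at $p$ of smooth curves in $N$ through $p$. Then $\mathrm{GL}(n)\times\mathbb R_+$, embedded by $(A,m)\mapsto(x\mapsto Ax,\,m)$, is a totally geodesic submanifold $N$ of $\mathrm{Diff}(\mathbb R^n)\times\mathbb R_+$. That is: (a) the inclusion is injective, and a finite-dimensional family $u\mapsto(A_u,m_u)$ is smooth in the Lie group $\mathrm{GL}(n)\times\mathbb R_+$ if and only if its image is a smooth family in $\mathrm{Diff}(\mathbb R^n)\times\mathbb R_+$; (b) every geodesic of $N$ (for the induced metric) is a geodesic of $\mathrm{Diff}(\mathbb R^n)\times\mathbb R_+$; (c) every geodesic $\gamma\colon J\to\mathrm{Diff}(\mathbb R^n)\times\mathbb R_+$ with $\gamma(t_0)\in N$ and $\dot\gamma(t_0)\in T_{\gamma(t_0)}N$ for some $t_0\in J$ satisfies $\gamma(t)\in N$ for all $t\in J$; (d) for every $p\in N$ and $v\in T_pN$ there are $\delta>0$ and a geodesic $\gamma$ of $\mathrm{Diff}(\mathbb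 R^n)\times\mathbb R_+$ on $(-\delta,\delta)$ with $\gamma(0)=p$, $\dot\gamma(0)=v$ and $\gamma(t)\in N$ for all $t$. -/

import Mathlib

open MeasureTheory ProbabilityTheory Set
open scoped Manifold ContDiff

noncomputable section

namespace ConeUOT

/-- `ℝⁿ` with its Euclidean norm. -/
abbrev Rn (n : ℕ) : Type := EuclideanSpace ℝ (Fin n)

/-- The group `Diff(ℝⁿ)` of all smooth diffeomorphisms of `ℝⁿ`. -/
abbrev DiffRn (n : ℕ) : Type := Diffeomorph 𝓘(ℝ, Rn n) 𝓘(ℝ, Rn n) (Rn n) (Rn n) ∞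

/-- The multiplicative group `ℝ₊` of positive reals. -/
abbrev PosReal : Type := {m : ℝ // 0 < m}

/-- The conical extension `Diff(ℝⁿ) × ℝ₊`, with points `(φ, m)`. -/
abbrev ConeDiff (n : ℕ) : Type := DiffRn n × PosReal

/-- The conical extension `GL(n) × ℝ₊`, with points `(A, m)`. -/
abbrev ConeGL (n : ℕ) : Type := Matrix.GeneralLinearGroup (Fin n) ℝ × PosReal

variable {n : ℕ}

/-- The vector field `x ↦ X x` given by a matrix `X`. -/
def linearMap (X : Matrix (Fin n) (Fin n) ℝ) (x : Rn n) : Rn n :=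
  WithLp.toLp 2 (X.mulVec x.ofLp)

lemma contDiff_linearMap (X : Matrix (Fin n) (Fin n) ℝ) : ContDiff ℝ ∞ (linearMap X) :=
  (Matrix.toEuclideanCLM (𝕜 := ℝ) X).contDiff

/-- The diffeomorphism `x ↦ A x` of `ℝⁿ` given by `A ∈ GL(n)`. -/
def linearDiffeo (A : Matrix.GeneralLinearGroup (Fin n) ℝ) : DiffRn n where
  toFun := linearMap (A : Matrix (Fin n) (Fin n) ℝ)
  invFun := linearMap ((A⁻¹ : Matrix.GeneralLinearGroup (Fin n) ℝ) : Matrix (Fin n) (Fin n) ℝ)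
  left_inv x := by
    simp only [linearMap, Matrix.mulVec_mulVec, Units.inv_mul, Matrix.one_mulVec]
  right_inv x := by
    simp only [linearMap, Matrix.mulVec_mulVec, Units.mul_inv, Matrix.one_mulVec]
  contMDiff_toFun := (contDiff_linearMap _).contMDiff
  contMDiff_invFun := (contDiff_linearMap _).contMDiff

/-- The inclusion `GL(n) × ℝ₊ → Diff(ℝⁿ) × ℝ₊`, `(A, m) ↦ (x ↦ A x, m)`. -/
def inclusion (p : ConeGL n) : ConeDiff n := (linearDiffeo p.1, p.2)

/-- Smooth families `u ↦ (A(u), m(u))` in the Lie group `GL(n) × ℝ₊`: the matrix entries and `m`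
are smooth functions of the parameter `u ∈ U`. -/
def SmoothFamilyGL {P : Type*} [NormedAddCommGroup P] [NormedSpace ℝ P]
    (f : P → ConeGL n) (U : Set P) : Prop :=
  (∀ i j, ContDiffOn ℝ ∞ (fun u => ((f u).1 : Matrix (Fin n) (Fin n) ℝ) i j) U) ∧
  ContDiffOn ℝ ∞ (fun u => ((f u).2 : ℝ)) U

/-- Smooth families `u ↦ (φ_u, m_u)` in `Diff(ℝⁿ) × ℝ₊`, for a reference measure `μ`:
`(u, x) ↦ φ_u(x)` is smooth, the displacement `u ↦ φ_u - φ₀` from some fixed diffeomorphism is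
a smooth map into `L²(μ; ℝⁿ)` (so that all the integrals in the metric are finite and depend
smoothly on the parameter), and `m_u` is smooth. Smooth curves are the case `P = ℝ`. -/
def SmoothFamily (μ : Measure (Rn n)) {P : Type*} [NormedAddCommGroup P] [NormedSpace ℝ P]
    (f : P → ConeDiff n) (U : Set P) : Prop :=
  ContDiffOn ℝ ∞ (fun q : P × Rn n => (f q.1).1 q.2) (U ×ˢ univ) ∧
  (∃ (φ₀ : DiffRn n) (F : P → Lp (Rn n) 2 μ), ContDiffOn ℝ ∞ F U ∧
    ∀ u ∈ U, F u =ᵐ[μ] fun x => (f u).1 x - φ₀ x) ∧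
  ContDiffOn ℝ ∞ (fun u => ((f u).2 : ℝ)) U

/-- A tangent vector `(φ̇, ṁ)` at a point of `Diff(ℝⁿ) × ℝ₊`; here `φ̇ = v ∘ φ` is a vector field
along `φ`. -/
abbrev TangentVec (n : ℕ) : Type := (Rn n → Rn n) × ℝ

/-- The natural UOT metric
`G_{(φ,m)}((φ̇,ṁ), (ψ̇,k)) = m ∫ ⟨φ̇, ψ̇⟩ dμ + ṁ k / m`; with `m = r²` it is the conical metric
`r² ∫ |φ̇|² dμ + 4 ṙ²` over the `L²` metric of `Diff(ℝⁿ)`. -/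
def uotMetric (μ : Measure (Rn n)) (p : ConeDiff n) (v w : TangentVec n) : ℝ :=
  (p.2 : ℝ) * ∫ x, inner ℝ (v.1 x) (w.1 x) ∂μ + v.2 * w.2 / (p.2 : ℝ)

/-- The velocity `(∂φ_t/∂t, ṁ(t))` of a curve `t ↦ (φ_t, m(t))`. -/
def velocity (γ : ℝ → ConeDiff n) (t : ℝ) : TangentVec n :=
  (fun x => deriv (fun s => (γ s).1 x) t, deriv (fun s => ((γ s).2 : ℝ)) t)

/-- The energy `½ ∫_a^b G(γ̇, γ̇) dt` of a curve on `[a, b]`. -/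
def energy (μ : Measure (Rn n)) (γ : ℝ → ConeDiff n) (a b : ℝ) : ℝ :=
  (1 / 2) * ∫ t in a..b, uotMetric μ (γ t) (velocity γ t) (velocity γ t)

/-- `Γ(s, t)`, `|s| < δ`, is a smooth variation through curves in `N` of the curve `γ` on the
interval `J`, with fixed ends at `a` and `b`. -/
structure IsVariation (μ : Measure (Rn n)) (N : Set (ConeDiff n)) (γ : ℝ → ConeDiff n)
    (J : Set ℝ) (a b δ : ℝ) (Γ : ℝ × ℝ → ConeDiff n) : Prop where
  smooth : SmoothFamily μ Γ (Ioo (-δ) δ ×ˢ J)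
  mem : ∀ s ∈ Ioo (-δ) δ, ∀ t ∈ J, Γ (s, t) ∈ N
  base : ∀ t ∈ J, Γ (0, t) = γ t
  left : ∀ s ∈ Ioo (-δ) δ, Γ (s, a) = γ a
  right : ∀ s ∈ Ioo (-δ) δ, Γ (s, b) = γ b

/-- `γ` is, on the open interval `J`, a geodesic of `N ⊆ Diff(ℝⁿ) × ℝ₊` for the metric that the
UOT metric induces on `N`: a smooth curve in `N` that is, on each `[a, b] ⊆ J`, a critical point of
the energy for smooth variations through curves in `N` with fixed ends. The geodesics of
`Diff(ℝⁿ) × ℝ₊` itself are the case `N = univ`. -/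
structure IsGeodesic (μ : Measure (Rn n)) (N : Set (ConeDiff n)) (γ : ℝ → ConeDiff n)
    (J : Set ℝ) : Prop where
  smooth : SmoothFamily μ γ J
  mem : ∀ t ∈ J, γ t ∈ N
  critical : ∀ a ∈ J, ∀ b ∈ J, a < b → ∀ δ > 0, ∀ Γ : ℝ × ℝ → ConeDiff n,
    IsVariation μ N γ J a b δ Γ → HasDerivAt (fun s => energy μ (fun t => Γ (s, t)) a b) 0 0

/-- The tangent space `T_p N`: the velocities at `p` of smooth curves in `N` through `p`. -/
def tangentVectors (μ : Measure (Rn n)) (N : Set (ConeDiff n)) (p : ConeDiff n) :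
    Set (TangentVec n) :=
  {v | ∃ δ > 0, ∃ c : ℝ → ConeDiff n, SmoothFamily μ c (Ioo (-δ) δ) ∧
    (∀ t ∈ Ioo (-δ) δ, c t ∈ N) ∧ c 0 = p ∧ velocity c 0 = v}

/-- `GL(n) × ℝ₊` is a submanifold of `Diff(ℝⁿ) × ℝ₊`: the inclusion is injective, and a
finite-dimensional family in `GL(n) × ℝ₊` is smooth exactly if it is smooth as a family in
`Diff(ℝⁿ) × ℝ₊` (so the manifold structure of `GL(n) × ℝ₊` is the one induced by the ambient
space). -/
def InclusionIsSubmanifold (μ : Measure (Rn n)) : Prop :=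
  Function.Injective (inclusion (n := n)) ∧
  ∀ (k : ℕ) (U : Set (Rn k)), IsOpen U → ∀ f : Rn k → ConeGL n,
    SmoothFamilyGL f U ↔ SmoothFamily μ (fun u => inclusion (f u)) U

/-- `N` is totally geodesic in `Diff(ℝⁿ) × ℝ₊` for the UOT metric: geodesics of `N` (for the induced
metric) are geodesics of the ambient space; an ambient geodesic that is tangent to `N` at one time
stays in `N`; and for each tangent vector of `N` there is, for a short time, an ambient geodesic
in `N` with this initial velocity. -/
structure IsTotallyGeodesic (μ : Measure (Rn n)) (N : Set (ConeDiff n)) : Prop where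
  ambient_geodesic : ∀ (γ : ℝ → ConeDiff n) (J : Set ℝ), IsOpen J → J.OrdConnected →
    IsGeodesic μ N γ J → IsGeodesic μ univ γ J
  stays : ∀ (γ : ℝ → ConeDiff n) (J : Set ℝ), IsOpen J → J.OrdConnected →
    IsGeodesic μ univ γ J → ∀ t₀ ∈ J, γ t₀ ∈ N →
    velocity γ t₀ ∈ tangentVectors μ N (γ t₀) → ∀ t ∈ J, γ t ∈ N
  exists_geodesic : ∀ p ∈ N, ∀ v ∈ tangentVectors μ N p, ∃ δ > 0, ∃ γ : ℝ → ConeDiff n,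
    IsGeodesic μ univ γ (Ioo (-δ) δ) ∧ (∀ t ∈ Ioo (-δ) δ, γ t ∈ N) ∧ γ 0 = p ∧ velocity γ 0 = v

end ConeUOT

end

/-! Only displacements enter the metric, and these lie in the fixed Hilbert space L²(μ). Along a
smooth curve with displacement F and mass m the energy is therefore ½ ∫ (m‖Ḟ‖² + ṁ²/m) dt, that of a
cone over a flat space. Its Euler–Lagrange equations, `GeodesicEquations`, say that the momentum m
φ̇ is constant in time and that m̈ = ½ G(γ̇, γ̇). A curve in any N that solves these equations is a
geodesic of N, because the first variation is then a boundary term (`GeodesicEquations.isGeodesic`).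
Conversely, criticality in N conserves the L² product of the momentum with every field w by which N
can be perturbed (`IsGeodesic.inner_momentum_eq`), and mass variations give the second equation
(`IsGeodesic.mass_equation`). In Diff(ℝⁿ) the fields w = η v, with η a bump function and v a
constant vector, suffice. In GL(n) only linear w are allowed, but the difference of the momenta at
two times is itself linear and can be tested against itself. In both cases the full support of μ
turns almost everywhere into everywhere. Hence geodesics of N and of the ambient space satisfy the
same equations, which gives (b). Constant momentum makes every φ̇_t a scalar multiple of φ̇_{t₀}, so
linear data stay linear, which gives (c). For (d) the equations are solved explicitly: m is
quadratic in t and φ_t = A + θ(t) B with θ' = m₀/m. -/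

noncomputable section

namespace ConeUOT

open Filter Topology

/-! ### Full support of nondegenerate Gaussian measures -/

section Gaussian

lemma isOpenPosMeasure_gaussianReal :
    (gaussianReal 0 1).IsOpenPosMeasure :=
  (gaussianReal_absolutelyContinuous' 0 one_ne_zero).isOpenPosMeasure

lemma isOpenPosMeasure_stdGaussian (E : Type*) [NormedAddCommGroup E] [InnerProductSpace ℝ E]
    [FiniteDimensional ℝ E] [MeasurableSpace E] [BorelSpace E] :
    (stdGaussian E).IsOpenPosMeasure := by
  have := isOpenPosMeasure_gaussianReal
  rw [stdGaussian]
  refine Continuous.isOpenPosMeasure_map (by fun_prop) fun y => ?_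
  exact ⟨fun i => (stdOrthonormalBasis ℝ E).repr y i, (stdOrthonormalBasis ℝ E).sum_repr y⟩

-- Positive definiteness makes the square root of S invertible, so the affine map that pushes the
-- standard Gaussian forward is onto. A continuous surjection preserves positivity on open sets.
open scoped MatrixOrder in
lemma isOpenPosMeasure_multivariateGaussian {ι : Type*} [Fintype ι] [DecidableEq ι]
    (m : EuclideanSpace ℝ ι) {S : Matrix ι ι ℝ} (hS : S.PosDef) :
    (multivariateGaussian m S).IsOpenPosMeasure := by
  have := isOpenPosMeasure_stdGaussian (EuclideanSpace ℝ ι)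
  rw [multivariateGaussian]
  refine Continuous.isOpenPosMeasure_map (by fun_prop) fun y => ?_
  have hu : IsUnit (CFC.sqrt S) := by
    have : CFC.sqrt S * CFC.sqrt S = S := CFC.sqrt_mul_sqrt_self S hS.posSemidef.nonneg
    exact isUnit_of_mul_isUnit_left (this ▸ hS.isUnit)
  obtain ⟨u, hu⟩ := hu
  refine ⟨Matrix.toEuclideanCLM (𝕜 := ℝ) (↑u⁻¹ : Matrix ι ι ℝ) (y - m), ?_⟩
  rw [← hu]
  simp only [← mul_apply_eq_comp, ← map_mul, Units.mul_inv, map_one]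
  simp

lemma memLp_continuousLinearMap {E F : Type*} [NormedAddCommGroup E] [NormedSpace ℝ E]
    [MeasurableSpace E] [BorelSpace E] [NormedAddCommGroup F] [NormedSpace ℝ F]
    {μ : Measure E} (h : MemLp id 2 μ) (T : E →L[ℝ] F) : MemLp T 2 μ :=
  T.comp_memLp' h

end Gaussian

/-! ### Derivatives in Lᵖ and pointwise derivatives -/

/-- The derivative of a curve in `Lᵖ` is represented by the pointwise derivative. -/
lemma hasDerivAt_Lp_ae_eq {X E : Type*} [MeasurableSpace X] {μ : Measure X}
    [NormedAddCommGroup E] [NormedSpace ℝ E] {c : ℝ → Lp E 2 μ} {c' : Lp E 2 μ} {t : ℝ}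
    (hc : HasDerivAt c c' t) {g : ℝ → X → E} {g' g₀ : X → E}
    (hg : ∀ x, HasDerivAt (fun s => g s x) (g' x) t)
    (hcg : ∀ᶠ s in 𝓝 t, c s =ᵐ[μ] fun x => g s x - g₀ x) : c' =ᵐ[μ] g' := by
  -- Along a sequence of times, convergence of the difference quotients in Lᵖ gives almost
  -- everywhere convergence of a subsequence. Countably many times also leave only one null set to
  -- discard.
  set u : ℕ → ℝ := fun k => t + 1 / ((k : ℝ) + 1) with hu
  have hpos : ∀ k : ℕ, (0 : ℝ) < 1 / ((k : ℝ) + 1) := fun k => by positivity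
  have hut : Tendsto u atTop (𝓝 t) := by
    simpa [hu] using (tendsto_const_nhds (x := t)).add (tendsto_one_div_add_atTop_nhds_zero_nat (𝕜 := ℝ))
  have hut' : Tendsto u atTop (𝓝[≠] t) :=
    tendsto_nhdsWithin_iff.2 ⟨hut, Eventually.of_forall fun k => by
      simp only [hu, mem_compl_iff, mem_singleton_iff]; linarith [hpos k]⟩
  have h1 : Tendsto (fun k => slope c t (u k)) atTop (𝓝 c') :=
    (hasDerivAt_iff_tendsto_slope.1 hc).comp hut'
  obtain ⟨ns, hns, hae⟩ := (tendstoInMeasure_of_tendsto_Lp h1).exists_seq_tendsto_ae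
  obtain ⟨k₀, hk₀⟩ := eventually_atTop.1 (hut.eventually hcg)
  have hall : ∀ᵐ x ∂μ, ∀ k, k₀ ≤ k → (slope c t (u k)) x = slope (fun s => g s x) t (u k) := by
    rw [ae_all_iff]
    intro k
    by_cases hk : k₀ ≤ k
    · have e1 := hk₀ k hk
      have e2 := hcg.self_of_nhds
      rw [slope_def_module]
      filter_upwards [e1, e2, Lp.coeFn_smul (u k - t)⁻¹ (c (u k) - c t),
        Lp.coeFn_sub (c (u k)) (c t)] with x h1 h2 h3 h4 _
      rw [h3, Pi.smul_apply, h4, Pi.sub_apply, h1, h2, slope_def_module]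
      congr 1
      abel
    · exact Eventually.of_forall fun x h => absurd h hk
  filter_upwards [hae, hall] with x hx hx'
  have h2 : Tendsto (fun k => slope (fun s => g s x) t (u (ns k))) atTop (𝓝 (g' x)) :=
    (hasDerivAt_iff_tendsto_slope.1 (hg x)).comp (hut'.comp hns.tendsto_atTop)
  refine tendsto_nhds_unique (hx.congr' ?_) h2
  filter_upwards [hns.tendsto_atTop.eventually_ge_atTop k₀] with k hk using hx' _ hk

/-! ### Small perturbations of the identity -/

section Diffeo

variable {E : Type*} [NormedAddCommGroup E] [NormedSpace ℝ E] [CompleteSpace E]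

/-- A smooth perturbation of the identity with Lipschitz constant less than one is a
diffeomorphism. -/
lemma exists_diffeomorph_id_add {g : E → E} (hg : ContDiff ℝ ∞ g) {c : NNReal} (hc : c < 1)
    (hbound : ∀ y, ‖fderiv ℝ g y‖₊ ≤ c) :
    ∃ ψ : Diffeomorph 𝓘(ℝ, E) 𝓘(ℝ, E) E E ∞, ∀ y, ψ y = y + g y := by
  have hd : Differentiable ℝ g := hg.differentiable (by simp)
  have hlip : LipschitzWith c g := lipschitzWith_of_nnnorm_fderiv_le hd hbound
  have happ : ApproximatesLinearOn (fun y => y + g y)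
      ((ContinuousLinearEquiv.refl ℝ E : E ≃L[ℝ] E) : E →L[ℝ] E) univ c := by
    rw [ApproximatesLinearOn.approximatesLinearOn_iff_lipschitzOnWith, lipschitzOnWith_univ]
    convert hlip using 1
    ext y
    simp
  -- The identity has norm 0 on the trivial space, which is the case n = 0, so that case is kept
  -- apart.
  have hc' : Subsingleton E ∨
      c < ‖((ContinuousLinearEquiv.refl ℝ E).symm : E →L[ℝ] E)‖₊⁻¹ := by
    rcases subsingleton_or_nontrivial E with h | h
    · exact Or.inl h
    · right
      have : ‖((ContinuousLinearEquiv.refl ℝ E).symm : E →L[ℝ] E)‖₊ = 1 := by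
        have : ((ContinuousLinearEquiv.refl ℝ E).symm : E →L[ℝ] E)
            = ContinuousLinearMap.id ℝ E := rfl
        rw [this, ContinuousLinearMap.nnnorm_id]
      rw [this]
      simpa using hc
  let H := happ.toHomeomorph _ hc'
  have hH : ∀ y, H y = y + g y := fun y => rfl
  have hsm : ContDiff ℝ ∞ (H : E → E) := contDiff_id.add hg
  have hnorm : ∀ y, ‖-fderiv ℝ g y‖ < 1 := fun y => by
    rw [norm_neg]
    exact lt_of_le_of_lt (NNReal.coe_le_coe.2 (hbound y)) (by exact_mod_cast hc)
  -- The derivative 1 + g'(y) = 1 - (-g'(y)) is invertible by the Neumann series, so the inverse of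
  -- H is smooth.
  have hder : ∀ y, HasFDerivAt H
      ((ContinuousLinearEquiv.ofUnit (Units.oneSub (-fderiv ℝ g y) (hnorm y)) : E ≃L[ℝ] E) :
        E →L[ℝ] E) y := fun y => by
    have := (hasFDerivAt_id (𝕜 := ℝ) y).add (hd y).hasFDerivAt
    have e : ((ContinuousLinearEquiv.ofUnit (Units.oneSub (-fderiv ℝ g y) (hnorm y)) : E ≃L[ℝ] E) :
        E →L[ℝ] E) = ContinuousLinearMap.id ℝ E + fderiv ℝ g y := by
      ext z
      change (1 - -fderiv ℝ g y) z = _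
      simp
    rw [e]
    exact this
  refine ⟨⟨H.toEquiv, hsm.contMDiff, (H.contDiff_symm hder hsm).contMDiff⟩, hH⟩

end Diffeo

/-! ### First variation of the cone energy over a Hilbert space -/

section FirstVariation

lemma hasDerivAt_intervalIntegral_of_contDiffOn {e : ℝ × ℝ → ℝ} {δ : ℝ} (hδ : 0 < δ) {J : Set ℝ}
    (hJ : IsOpen J) {a b : ℝ} (hab : a ≤ b) (hsub : Icc a b ⊆ J)
    (he : ContDiffOn ℝ 1 e (Ioo (-δ) δ ×ˢ J)) :
    HasDerivAt (fun s => ∫ t in a..b, e (s, t)) (∫ t in a..b, fderiv ℝ e (0, t) (1, 0)) 0 := by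
  have hopen : IsOpen (Ioo (-δ) δ ×ˢ J) := isOpen_Ioo.prod hJ
  -- Halving δ gives a compact rectangle, on which the s-derivative has the constant bound needed
  -- for differentiation under the integral.
  have hsub' : Icc (-(δ / 2)) (δ / 2) ×ˢ Icc a b ⊆ Ioo (-δ) δ ×ˢ J :=
    prod_mono (fun s hs => ⟨by linarith [hs.1], by linarith [hs.2]⟩) hsub
  have hcont : ContinuousOn (fun q => fderiv ℝ e q (1, 0)) (Ioo (-δ) δ ×ˢ J) :=
    (he.continuousOn_fderiv_of_isOpen hopen le_rfl).clm_apply continuousOn_const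
  obtain ⟨C, hC⟩ := (isCompact_Icc.prod isCompact_Icc).exists_bound_of_continuousOn
    (hcont.mono hsub')
  have hslice : ∀ {f : ℝ × ℝ → ℝ}, ContinuousOn f (Ioo (-δ) δ ×ˢ J) → ∀ s ∈ Ioo (-δ) δ,
      ContinuousOn (fun t => f (s, t)) (uIcc a b) := fun hf s hs => by
    rw [uIcc_of_le hab]
    exact hf.comp (by fun_prop) fun t ht => ⟨hs, hsub ht⟩
  have hmem : Ioo (-(δ / 2)) (δ / 2) ∈ 𝓝 (0 : ℝ) := Ioo_mem_nhds (by linarith) (by linarith)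
  have hlt : ∀ s ∈ Ioo (-(δ / 2)) (δ / 2), s ∈ Ioo (-δ) δ := fun s hs =>
    ⟨by linarith [hs.1], by linarith [hs.2]⟩
  have h0 : (0 : ℝ) ∈ Ioo (-δ) δ := ⟨by linarith, hδ⟩
  refine (intervalIntegral.hasDerivAt_integral_of_dominated_loc_of_deriv_le
    (F := fun s t => e (s, t)) (F' := fun s t => fderiv ℝ e (s, t) (1, 0)) (bound := fun _ => C)
    hmem ?_ ?_ ?_ ?_ ?_ ?_).2
  · filter_upwards [hmem] with s hs
    exact (intervalIntegrable_iff.1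
      (hslice he.continuousOn s (hlt s hs)).intervalIntegrable).aestronglyMeasurable
  · exact (hslice he.continuousOn 0 h0).intervalIntegrable
  · exact (intervalIntegrable_iff.1 (hslice hcont 0 h0).intervalIntegrable).aestronglyMeasurable
  · refine Eventually.of_forall fun t ht s hs => hC (s, t) ⟨Ioo_subset_Icc_self hs, ?_⟩
    rw [uIoc_of_le hab] at ht
    exact Ioc_subset_Icc_self ht
  · exact intervalIntegrable_const
  · refine Eventually.of_forall fun t ht s hs => ?_
    rw [uIoc_of_le hab] at ht
    have hd : DifferentiableAt ℝ e (s, t) :=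
      (he.differentiableOn one_ne_zero).differentiableAt
        (hopen.mem_nhds ⟨hlt s hs, hsub (Ioc_subset_Icc_self ht)⟩)
    have h2 : HasDerivAt (fun r : ℝ => (r, t)) (1, 0) s :=
      (hasDerivAt_id s).prodMk (hasDerivAt_const s t)
    exact hd.hasFDerivAt.comp_hasDerivAt s h2

variable {H : Type*} [NormedAddCommGroup H] [InnerProductSpace ℝ H]

/-- Interchange of the two partial derivatives of a smooth map of two variables. -/
lemma hasDerivAt_fderiv_apply_swap {F : ℝ × ℝ → H} {U : Set (ℝ × ℝ)} (hU : IsOpen U)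
    (hF : ContDiffOn ℝ ∞ F U) {t : ℝ} (ht : (0, t) ∈ U) :
    HasDerivAt (fun r => fderiv ℝ F (0, r) (1, 0)) (fderiv ℝ (fderiv ℝ F) (0, t) (1, 0) (0, 1)) t := by
  have hat : ContDiffAt ℝ ∞ F (0, t) := hF.contDiffAt (hU.mem_nhds ht)
  have hd : DifferentiableAt ℝ (fderiv ℝ F) (0, t) :=
    (hat.fderiv_right (m := 1) (by norm_cast)).differentiableAt (by simp)
  have hsymm : IsSymmSndFDerivAt ℝ F (0, t) := hat.isSymmSndFDerivAt (by simpa using (by norm_cast : (2 : ℕ∞ω) ≤ ∞))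
  have h2 : HasDerivAt (fun r : ℝ => ((0 : ℝ), r)) (0, 1) t :=
    (hasDerivAt_const t (0 : ℝ)).prodMk (hasDerivAt_id t)
  have h3 := (hd.hasFDerivAt.comp_hasDerivAt t h2).clm_apply (hasDerivAt_const t ((1 : ℝ), (0 : ℝ)))
  rw [hsymm.eq]
  simpa using h3

lemma hasDerivAt_fderiv_apply_fst {F : ℝ × ℝ → H} {U : Set (ℝ × ℝ)} (hU : IsOpen U)
    (hF : ContDiffOn ℝ ∞ F U) {t : ℝ} (ht : (0, t) ∈ U) :
    HasDerivAt (fun s : ℝ => fderiv ℝ F (s, t) ((0 : ℝ), (1 : ℝ)))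
      (fderiv ℝ (fderiv ℝ F) ((0 : ℝ), t) ((1 : ℝ), (0 : ℝ)) ((0 : ℝ), (1 : ℝ))) (0 : ℝ) := by
  have hd : DifferentiableAt ℝ (fderiv ℝ F) (0, t) :=
    ((hF.contDiffAt (hU.mem_nhds ht)).fderiv_right (m := 1) (by norm_cast)).differentiableAt
      (by simp)
  have line : HasDerivAt (fun s : ℝ => (s, t)) (1, 0) 0 :=
    (hasDerivAt_id (0 : ℝ)).prodMk (hasDerivAt_const 0 t)
  have h3 := hd.hasFDerivAt.comp_hasDerivAt (0 : ℝ) line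
  exact (ContinuousLinearMap.apply ℝ H ((0 : ℝ), (1 : ℝ))).hasFDerivAt.comp_hasDerivAt (0 : ℝ) h3

lemma hasDerivAt_coneDensity {f : ℝ → H} {m k : ℝ → ℝ} {f' : H} {m' k' s : ℝ}
    (hf : HasDerivAt f f' s) (hm : HasDerivAt m m' s) (hk : HasDerivAt k k' s) (hs : m s ≠ 0) :
    HasDerivAt (fun r => m r * inner ℝ (f r) (f r) + k r * k r / m r)
      (m' * inner ℝ (f s) (f s) + 2 * m s * inner ℝ (f s) f' + 2 * (k s / m s) * k'
        - (k s / m s) ^ 2 * m') s := by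
  refine ((hm.mul (hf.inner ℝ hf)).add ((hk.mul hk).div hm hs)).congr_deriv ?_
  rw [real_inner_comm (f s) f', Pi.mul_apply]
  field_simp
  ring

/-- The first variation of the cone energy
`½ ∫ M ‖∂ₜ F‖² + (∂ₜ M)² / M dt`. -/
lemma hasDerivAt_coneEnergy {F : ℝ × ℝ → H} {M : ℝ × ℝ → ℝ} {δ : ℝ} (hδ : 0 < δ) {J : Set ℝ}
    (hJ : IsOpen J) {a b : ℝ} (hab : a ≤ b) (hsub : Icc a b ⊆ J)
    (hF : ContDiffOn ℝ ∞ F (Ioo (-δ) δ ×ˢ J)) (hM : ContDiffOn ℝ ∞ M (Ioo (-δ) δ ×ˢ J))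
    (hpos : ∀ q ∈ Ioo (-δ) δ ×ˢ J, 0 < M q) :
    HasDerivAt (fun s => (1 / 2) * ∫ t in a..b,
        (M (s, t) * inner ℝ (fderiv ℝ F (s, t) (0, 1)) (fderiv ℝ F (s, t) (0, 1))
          + fderiv ℝ M (s, t) (0, 1) * fderiv ℝ M (s, t) (0, 1) / M (s, t)))
      (∫ t in a..b,
        (1 / 2 * fderiv ℝ M (0, t) (1, 0)
            * inner ℝ (fderiv ℝ F (0, t) (0, 1)) (fderiv ℝ F (0, t) (0, 1))
          + M (0, t) * inner ℝ (fderiv ℝ F (0, t) (0, 1))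
              (deriv (fun r => fderiv ℝ F (0, r) (1, 0)) t)
          + fderiv ℝ M (0, t) (0, 1) / M (0, t) * deriv (fun r => fderiv ℝ M (0, r) (1, 0)) t
          - 1 / 2 * (fderiv ℝ M (0, t) (0, 1) / M (0, t)) ^ 2 * fderiv ℝ M (0, t) (1, 0))) 0 := by
  have hopen : IsOpen (Ioo (-δ) δ ×ˢ J) := isOpen_Ioo.prod hJ
  have hF' : ContDiffOn ℝ 1 (fun q => fderiv ℝ F q (0, 1)) (Ioo (-δ) δ ×ˢ J) :=
    (hF.fderiv_of_isOpen hopen (m := 1) (by norm_cast)).clm_apply contDiffOn_const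
  have hM' : ContDiffOn ℝ 1 (fun q => fderiv ℝ M q (0, 1)) (Ioo (-δ) δ ×ˢ J) :=
    (hM.fderiv_of_isOpen hopen (m := 1) (by norm_cast)).clm_apply contDiffOn_const
  have hM1 : ContDiffOn ℝ 1 M (Ioo (-δ) δ ×ˢ J) := hM.of_le (by norm_cast)
  have he : ContDiffOn ℝ 1 (fun q => M q * inner ℝ (fderiv ℝ F q (0, 1)) (fderiv ℝ F q (0, 1))
      + fderiv ℝ M q (0, 1) * fderiv ℝ M q (0, 1) / M q) (Ioo (-δ) δ ×ˢ J) :=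
    (hM1.mul (hF'.inner ℝ hF')).add ((hM'.mul hM').div hM1 fun q hq => (hpos q hq).ne')
  refine ((hasDerivAt_intervalIntegral_of_contDiffOn hδ hJ hab hsub he).const_mul
    (1 / 2 : ℝ)).congr_deriv ?_
  symm
  rw [← intervalIntegral.integral_const_mul]
  refine intervalIntegral.integral_congr fun t ht => ?_
  rw [uIcc_of_le hab] at ht
  have hq : ((0 : ℝ), t) ∈ Ioo (-δ) δ ×ˢ J := ⟨⟨by linarith, hδ⟩, hsub ht⟩
  have hn := hopen.mem_nhds hq
  have hp := (hpos _ hq).ne'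
  have line : HasDerivAt (fun s : ℝ => (s, t)) (1, 0) 0 :=
    (hasDerivAt_id (0 : ℝ)).prodMk (hasDerivAt_const 0 t)
  have dF := hasDerivAt_fderiv_apply_fst hopen hF hq
  have dM' := hasDerivAt_fderiv_apply_fst hopen hM hq
  have dM : HasDerivAt (fun s : ℝ => M (s, t)) (fderiv ℝ M (0, t) (1, 0)) 0 :=
    ((hM1.contDiffAt hn).differentiableAt (by simp)).hasFDerivAt.comp_hasDerivAt (0 : ℝ) line
  have hE' := ((he.contDiffAt hn).differentiableAt (by simp)).hasFDerivAt.comp_hasDerivAt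
    (0 : ℝ) line
  simp only [hE'.unique (hasDerivAt_coneDensity dF dM dM' hp),
    (hasDerivAt_fderiv_apply_swap hopen hF hq).deriv,
    (hasDerivAt_fderiv_apply_swap hopen hM hq).deriv]
  ring

end FirstVariation

section Slices

variable {H : Type*} [NormedAddCommGroup H] [NormedSpace ℝ H]

lemma hasDerivAt_slice_fst {G : ℝ × ℝ → H} {s t : ℝ} (hG : DifferentiableAt ℝ G (s, t)) :
    HasDerivAt (fun r => G (r, t)) (fderiv ℝ G (s, t) (1, 0)) s :=
  hG.hasFDerivAt.comp_hasDerivAt s ((hasDerivAt_id s).prodMk (hasDerivAt_const s t))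

lemma hasDerivAt_slice_snd {G : ℝ × ℝ → H} {s t : ℝ} (hG : DifferentiableAt ℝ G (s, t)) :
    HasDerivAt (fun r => G (s, r)) (fderiv ℝ G (s, t) (0, 1)) t :=
  hG.hasFDerivAt.comp_hasDerivAt t ((hasDerivAt_const t s).prodMk (hasDerivAt_id t))

end Slices

/-! ### Curves and variations of diffeomorphisms, seen in L² -/

variable {n : ℕ} {μ : Measure (Rn n)}

/-- The points of a jointly smooth family of diffeomorphisms move differentiably, with the
velocity of the family. -/
lemma hasDerivAt_apply {γ : ℝ → ConeDiff n} {J : Set ℝ} (hJ : IsOpen J)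
    (h : ContDiffOn ℝ ∞ (fun q : ℝ × Rn n => (γ q.1).1 q.2) (J ×ˢ univ)) {t : ℝ} (ht : t ∈ J)
    (x : Rn n) : HasDerivAt (fun s => (γ s).1 x) ((velocity γ t).1 x) t := by
  have hd : DifferentiableAt ℝ (fun q : ℝ × Rn n => (γ q.1).1 q.2) (t, x) :=
    (h.contDiffAt ((hJ.prod isOpen_univ).mem_nhds ⟨ht, mem_univ x⟩)).differentiableAt (by simp)
  have hl : DifferentiableAt ℝ (fun s : ℝ => (s, x)) t := by fun_prop
  exact (DifferentiableAt.comp (f := fun s : ℝ => (s, x)) t hd hl).hasDerivAt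

lemma continuous_velocity {γ : ℝ → ConeDiff n} {J : Set ℝ} (hJ : IsOpen J)
    (h : ContDiffOn ℝ ∞ (fun q : ℝ × Rn n => (γ q.1).1 q.2) (J ×ˢ univ)) {t : ℝ} (ht : t ∈ J) :
    Continuous (velocity γ t).1 := by
  have hopen : IsOpen (J ×ˢ (univ : Set (Rn n))) := hJ.prod isOpen_univ
  have hc : ContinuousOn (fun q => fderiv ℝ (fun q : ℝ × Rn n => (γ q.1).1 q.2) q (1, 0))
      (J ×ˢ univ) :=
    (h.continuousOn_fderiv_of_isOpen hopen (by simp)).clm_apply continuousOn_const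
  have hc' : Continuous fun x : Rn n =>
      fderiv ℝ (fun q : ℝ × Rn n => (γ q.1).1 q.2) (t, x) (1, 0) :=
    hc.comp_continuous (by fun_prop) fun x => ⟨ht, mem_univ x⟩
  convert hc' using 1
  ext1 x
  have hd : DifferentiableAt ℝ (fun q : ℝ × Rn n => (γ q.1).1 q.2) (t, x) :=
    (h.contDiffAt (hopen.mem_nhds ⟨ht, mem_univ x⟩)).differentiableAt (by simp)
  exact (hd.hasFDerivAt.comp_hasDerivAt t
    ((hasDerivAt_id t).prodMk (hasDerivAt_const t x))).deriv

/-- The velocity of a smooth curve is represented by the derivative of its displacement in `L²`. -/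
lemma deriv_displacement_ae_eq {γ : ℝ → ConeDiff n} {J : Set ℝ} (hJ : IsOpen J)
    (h : ContDiffOn ℝ ∞ (fun q : ℝ × Rn n => (γ q.1).1 q.2) (J ×ˢ univ))
    {φ₀ : Rn n → Rn n} {F : ℝ → Lp (Rn n) 2 μ} (hF : ∀ t ∈ J, F t =ᵐ[μ] fun x => (γ t).1 x - φ₀ x)
    {t : ℝ} {V : Lp (Rn n) 2 μ} (ht : t ∈ J) (hd : HasDerivAt F V t) :
    V =ᵐ[μ] (velocity γ t).1 :=
  hasDerivAt_Lp_ae_eq hd (fun x => hasDerivAt_apply hJ h ht x)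
    (by filter_upwards [hJ.mem_nhds ht] with s hs using hF s hs)

/-- The metric sees velocities only up to null sets, so it can be computed in L²(μ), where the
Hilbert space formulas apply. -/
lemma uotMetric_eq_inner {p : ConeDiff n} {v w : TangentVec n} {V W : Lp (Rn n) 2 μ}
    (hv : V =ᵐ[μ] v.1) (hw : W =ᵐ[μ] w.1) :
    uotMetric μ p v w = (p.2 : ℝ) * inner ℝ V W + v.2 * w.2 / (p.2 : ℝ) := by
  rw [uotMetric, L2.inner_def]
  congr 2
  refine integral_congr_ae ?_
  filter_upwards [hv, hw] with x h1 h2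
  rw [h1, h2]

lemma velocity_congr {γ γ' : ℝ → ConeDiff n} {t : ℝ} (h : γ =ᶠ[𝓝 t] γ') :
    velocity γ t = velocity γ' t := by
  refine Prod.ext ?_ ?_
  · ext1 x
    exact Filter.EventuallyEq.deriv_eq (h.fun_comp fun p => p.1 x)
  · exact Filter.EventuallyEq.deriv_eq (h.fun_comp fun p => (p.2 : ℝ))

section Variation

variable {Γ : ℝ × ℝ → ConeDiff n} {δ : ℝ} {J : Set ℝ} {φ₀ : Rn n → Rn n}
  {F : ℝ × ℝ → Lp (Rn n) 2 μ}

lemma variation_velocity_ae_eq (hJ : IsOpen J)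
    (hΓ : ContDiffOn ℝ ∞ (fun q : (ℝ × ℝ) × Rn n => (Γ q.1).1 q.2)
      ((Ioo (-δ) δ ×ˢ J) ×ˢ univ))
    (hF : ContDiffOn ℝ ∞ F (Ioo (-δ) δ ×ˢ J))
    (hFΓ : ∀ q ∈ Ioo (-δ) δ ×ˢ J, F q =ᵐ[μ] fun x => (Γ q).1 x - φ₀ x)
    {s t : ℝ} (hs : s ∈ Ioo (-δ) δ) (ht : t ∈ J) :
    fderiv ℝ F (s, t) (0, 1) =ᵐ[μ] (velocity (fun r => Γ (s, r)) t).1 := by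
  have hopen : IsOpen (Ioo (-δ) δ ×ˢ J) := isOpen_Ioo.prod hJ
  refine deriv_displacement_ae_eq (γ := fun r => Γ (s, r)) (φ₀ := φ₀) (F := fun r => F (s, r))
    hJ ?_ (fun r hr => hFΓ (s, r) ⟨hs, hr⟩) ht
    (hasDerivAt_slice_snd ((hF.contDiffAt (hopen.mem_nhds ⟨hs, ht⟩)).differentiableAt (by simp)))
  exact hΓ.comp (f := fun q : ℝ × Rn n => ((s, q.1), q.2)) (by fun_prop)
    fun q hq => ⟨⟨hs, hq.1⟩, mem_univ _⟩

/-- The first variation formula for the energy in `Diff(ℝⁿ) × ℝ₊`. -/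
lemma hasDerivAt_energy (hδ : 0 < δ) (hJ : IsOpen J) {a b : ℝ} (hab : a ≤ b)
    (hsub : Icc a b ⊆ J)
    (hΓ : ContDiffOn ℝ ∞ (fun q : (ℝ × ℝ) × Rn n => (Γ q.1).1 q.2)
      ((Ioo (-δ) δ ×ˢ J) ×ˢ univ))
    (hF : ContDiffOn ℝ ∞ F (Ioo (-δ) δ ×ˢ J))
    (hFΓ : ∀ q ∈ Ioo (-δ) δ ×ˢ J, F q =ᵐ[μ] fun x => (Γ q).1 x - φ₀ x)
    {M : ℝ × ℝ → ℝ} (hM : ContDiffOn ℝ ∞ M (Ioo (-δ) δ ×ˢ J)) (hMΓ : ∀ q, M q = (Γ q).2) :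
    HasDerivAt (fun s => energy μ (fun t => Γ (s, t)) a b)
      (∫ t in a..b,
        (1 / 2 * fderiv ℝ M (0, t) (1, 0)
            * inner ℝ (fderiv ℝ F (0, t) (0, 1)) (fderiv ℝ F (0, t) (0, 1))
          + M (0, t) * inner ℝ (fderiv ℝ F (0, t) (0, 1))
              (deriv (fun r => fderiv ℝ F (0, r) (1, 0)) t)
          + fderiv ℝ M (0, t) (0, 1) / M (0, t) * deriv (fun r => fderiv ℝ M (0, r) (1, 0)) t
          - 1 / 2 * (fderiv ℝ M (0, t) (0, 1) / M (0, t)) ^ 2 * fderiv ℝ M (0, t) (1, 0))) 0 := by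
  have hopen : IsOpen (Ioo (-δ) δ ×ˢ J) := isOpen_Ioo.prod hJ
  refine (hasDerivAt_coneEnergy hδ hJ hab hsub hF hM
    fun q _ => hMΓ q ▸ (Γ q).2.2).congr_of_eventuallyEq ?_
  filter_upwards [Ioo_mem_nhds (by linarith : -δ < 0) hδ] with s hs
  rw [energy]
  congr 1
  refine intervalIntegral.integral_congr fun t ht => ?_
  rw [uIcc_of_le hab] at ht
  have hv := variation_velocity_ae_eq hJ hΓ hF hFΓ hs (hsub ht)
  have hm : (velocity (fun r => Γ (s, r)) t).2 = fderiv ℝ M (s, t) (0, 1) := by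
    rw [← (hasDerivAt_slice_snd ((hM.contDiffAt (hopen.mem_nhds ⟨hs, hsub ht⟩)).differentiableAt
      (by simp))).deriv]
    simp only [hMΓ]
    rfl
  simp only [uotMetric_eq_inner hv hv, hm, hMΓ]

end Variation

/-! ### Solutions of the geodesic equations are geodesics -/

/-- The geodesic equations: the momentum `m φ̇` is constant, and `m̈ = ½ G(γ̇, γ̇)`. -/
structure GeodesicEquations (μ : Measure (Rn n)) (γ : ℝ → ConeDiff n) (J : Set ℝ) : Prop where
  momentum : ∀ t ∈ J, ∀ t' ∈ J, ∀ x,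
    ((γ t).2 : ℝ) • (velocity γ t).1 x = ((γ t').2 : ℝ) • (velocity γ t').1 x
  mass : ∀ t ∈ J, deriv (deriv fun r => ((γ r).2 : ℝ)) t =
    1 / 2 * uotMetric μ (γ t) (velocity γ t) (velocity γ t)

/-- Under the equations the first variation integrand is a total derivative, and fixed ends make the
boundary term vanish. Nothing about N is needed, since a smaller N only has fewer variations. -/
theorem GeodesicEquations.isGeodesic {N : Set (ConeDiff n)} {γ : ℝ → ConeDiff n} {J : Set ℝ}
    (h : GeodesicEquations μ γ J) (hJ : IsOpen J) (hJ' : J.OrdConnected)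
    (hsm : SmoothFamily μ γ J) (hmem : ∀ t ∈ J, γ t ∈ N) : IsGeodesic μ N γ J := by
  refine ⟨hsm, hmem, fun a ha b hb hab δ hδ Γ hΓ => ?_⟩
  have hsub : Icc a b ⊆ J := hJ'.out ha hb
  obtain ⟨hjoint, ⟨φ₀, F, hF, hFΓ⟩, hM⟩ := hΓ.smooth
  set M : ℝ × ℝ → ℝ := fun q => (Γ q).2 with hMdef
  have hopen : IsOpen (Ioo (-δ) δ ×ˢ J) := isOpen_Ioo.prod hJ
  have h0 : (0 : ℝ) ∈ Ioo (-δ) δ := ⟨by linarith, hδ⟩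
  have hn : ∀ t ∈ J, Ioo (-δ) δ ×ˢ J ∈ 𝓝 ((0 : ℝ), t) := fun t ht => hopen.mem_nhds ⟨h0, ht⟩
  refine (hasDerivAt_energy hδ hJ hab.le hsub hjoint hF hFΓ hM fun q => rfl).congr_deriv ?_
  have hpos : ∀ q, 0 < M q := fun q => (Γ q).2.2
  have hMt : ∀ t ∈ J, M (0, t) = (γ t).2 := fun t ht => by rw [hMdef]; simp only [hΓ.base t ht]
  have hV : ∀ t ∈ J, fderiv ℝ F (0, t) (0, 1) =ᵐ[μ] (velocity γ t).1 := fun t ht => by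
    have h1 := variation_velocity_ae_eq hJ hjoint hF hFΓ h0 ht
    rwa [velocity_congr (γ' := γ) (by
      filter_upwards [hJ.mem_nhds ht] with r hr using hΓ.base r hr)] at h1
  have hP : ∀ t ∈ Icc a b, M (0, t) • fderiv ℝ F (0, t) (0, 1)
      = M (0, a) • fderiv ℝ F (0, a) (0, 1) := fun t ht => by
    refine Lp.ext ?_
    filter_upwards [hV t (hsub ht), hV a ha, Lp.coeFn_smul (M (0, t)) (fderiv ℝ F (0, t) (0, 1)),
      Lp.coeFn_smul (M (0, a)) (fderiv ℝ F (0, a) (0, 1))] with x h1 h2 h3 h4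
    rw [h3, h4, Pi.smul_apply, Pi.smul_apply, h1, h2, hMt t (hsub ht), hMt a ha]
    exact h.momentum t (hsub ht) a ha x
  set P := M (0, a) • fderiv ℝ F (0, a) (0, 1)
  have hMd : ∀ t ∈ J, fderiv ℝ M (0, t) (0, 1) = deriv (fun r => ((γ r).2 : ℝ)) t := fun t ht => by
    rw [← (hasDerivAt_slice_snd ((hM.contDiffAt (hn t ht)).differentiableAt (by simp))).deriv]
    exact Filter.EventuallyEq.deriv_eq (by filter_upwards [hJ.mem_nhds ht] with r hr using hMt r hr)
  have hmsm : ContDiffOn ℝ ∞ (fun r => ((γ r).2 : ℝ)) J := hsm.2.2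
  have hdm : ContDiffOn ℝ ∞ (deriv fun r => ((γ r).2 : ℝ)) J :=
    hmsm.deriv_of_isOpen hJ (by simp)
  have hξ : ContDiffOn ℝ ∞ (fun r => fderiv ℝ F (0, r) (1, 0)) J :=
    ((hF.fderiv_of_isOpen hopen (m := ∞) (by simp)).clm_apply contDiffOn_const).comp
      (by fun_prop : ContDiffOn ℝ ∞ (fun r : ℝ => ((0 : ℝ), r)) J) fun r hr => ⟨h0, hr⟩
  have hk : ContDiffOn ℝ ∞ (fun r => fderiv ℝ M (0, r) (1, 0)) J :=
    ((hM.fderiv_of_isOpen hopen (m := ∞) (by simp)).clm_apply contDiffOn_const).comp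
      (by fun_prop : ContDiffOn ℝ ∞ (fun r : ℝ => ((0 : ℝ), r)) J) fun r hr => ⟨h0, hr⟩
  -- The boundary term: with variation fields ξ of the displacement and k of the mass, g = ⟨P, ξ⟩ +
  -- (ṁ/m) k, where P is the constant momentum.
  set g : ℝ → ℝ := fun t => inner ℝ P (fderiv ℝ F (0, t) (1, 0))
    + deriv (fun r => ((γ r).2 : ℝ)) t / (γ t).2 * fderiv ℝ M (0, t) (1, 0) with hg
  have hgsm : ContDiffOn ℝ ∞ g J :=
    (contDiffOn_const.inner ℝ hξ).add ((hdm.div hmsm fun t _ => (γ t).2.2.ne').mul hk)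
  have hint : ∀ t ∈ Icc a b, 1 / 2 * fderiv ℝ M (0, t) (1, 0)
            * inner ℝ (fderiv ℝ F (0, t) (0, 1)) (fderiv ℝ F (0, t) (0, 1))
          + M (0, t) * inner ℝ (fderiv ℝ F (0, t) (0, 1))
              (deriv (fun r => fderiv ℝ F (0, r) (1, 0)) t)
          + fderiv ℝ M (0, t) (0, 1) / M (0, t) * deriv (fun r => fderiv ℝ M (0, r) (1, 0)) t
          - 1 / 2 * (fderiv ℝ M (0, t) (0, 1) / M (0, t)) ^ 2 * fderiv ℝ M (0, t) (1, 0)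
        = deriv g t := fun t ht => by
    have htJ := hsub ht
    have d1 := ((hξ.contDiffAt (hJ.mem_nhds htJ)).differentiableAt (by simp)).hasDerivAt
    have d2 := ((hk.contDiffAt (hJ.mem_nhds htJ)).differentiableAt (by simp)).hasDerivAt
    have d3 := ((hdm.contDiffAt (hJ.mem_nhds htJ)).differentiableAt (by simp)).hasDerivAt
    have d4 := ((hmsm.contDiffAt (hJ.mem_nhds htJ)).differentiableAt (by simp)).hasDerivAt
    have hne : ((γ t).2 : ℝ) ≠ 0 := (γ t).2.2.ne'
    have d5 : HasDerivAt g _ t :=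
      ((hasDerivAt_const t P).inner ℝ d1).add ((d3.div d4 hne).mul d2)
    rw [d5.deriv, h.mass t htJ, uotMetric_eq_inner (hV t htJ) (hV t htJ), hMd t htJ, ← hP t ht,
      hMt t htJ, inner_zero_left, real_inner_smul_left]
    simp only [velocity, Pi.div_apply]
    field_simp
    ring
  rw [intervalIntegral.integral_congr (g := deriv g) fun t ht => by
    rw [uIcc_of_le hab.le] at ht; exact hint t ht]
  rw [intervalIntegral.integral_deriv_eq_sub]
  · have hend : ∀ c ∈ J, (∀ s ∈ Ioo (-δ) δ, Γ (s, c) = γ c) → g c = 0 := fun c hc hΓc => by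
      have e1 : fderiv ℝ F (0, c) (1, 0) = 0 := by
        rw [← (hasDerivAt_slice_fst ((hF.contDiffAt (hn c hc)).differentiableAt (by simp))).deriv]
        rw [Filter.EventuallyEq.deriv_eq (f := fun _ => F (0, c)), deriv_const]
        filter_upwards [isOpen_Ioo.mem_nhds h0] with s hs
        refine Lp.ext ((hFΓ (s, c) ⟨hs, hc⟩).trans ?_)
        rw [hΓc s hs, ← hΓc 0 h0]
        exact (hFΓ (0, c) ⟨h0, hc⟩).symm
      have e2 : fderiv ℝ M (0, c) (1, 0) = 0 := by
        rw [← (hasDerivAt_slice_fst ((hM.contDiffAt (hn c hc)).differentiableAt (by simp))).deriv]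
        rw [Filter.EventuallyEq.deriv_eq (f := fun _ => M (0, c)), deriv_const]
        filter_upwards [isOpen_Ioo.mem_nhds h0] with s hs
        simp only [hMdef, hΓc s hs, hΓc 0 h0]
      simp only [hg, e1, e2, inner_zero_right, mul_zero, add_zero]
    rw [hend a ha hΓ.left, hend b hb hΓ.right, sub_zero]
  · intro t ht
    rw [uIcc_of_le hab.le] at ht
    exact (hgsm.contDiffAt (hJ.mem_nhds (hsub ht))).differentiableAt (by simp)
  · refine ContinuousOn.intervalIntegrable ?_
    rw [uIcc_of_le hab.le]
    exact (hgsm.continuousOn_deriv_of_isOpen hJ (by simp)).mono hsub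

/-! ### Geodesics satisfy the conservation law and the mass equation -/

/-- A smooth nonnegative function that is positive exactly on `(a, b)`. -/
lemma exists_contDiff_support_eq_Ioo (a b : ℝ) :
    ∃ f : ℝ → ℝ, ContDiff ℝ ∞ f ∧ (∀ t, 0 ≤ f t) ∧ (∀ t ∈ Ioo a b, 0 < f t) ∧
      ∀ t, t ∉ Ioo a b → f t = 0 := by
  obtain ⟨f, hsupp, hf, hr⟩ := (isOpen_Ioo (a := a) (b := b)).exists_contDiff_support_eq (n := ⊤)
  have h0 : ∀ t, 0 ≤ f t := fun t => (hr ⟨t, rfl⟩).1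
  refine ⟨f, hf, h0, fun t ht => ?_, fun t ht => ?_⟩
  · exact lt_of_le_of_ne (h0 t) (Ne.symm (by rw [← Function.mem_support, hsupp]; exact ht))
  · by_contra hne
    exact ht (hsupp ▸ Function.mem_support.2 hne)

lemma eq_zero_of_integral_mul_sq_eq_zero {f R : ℝ → ℝ} {a b : ℝ} (hab : a < b)
    (hf : Continuous f) (h0 : ∀ t, 0 ≤ f t) (hpos : ∀ t ∈ Ioo a b, 0 < f t)
    (hR : ContinuousOn R (Icc a b)) (hint : ∫ t in a..b, f t * R t ^ 2 = 0) :
    ∀ t ∈ Ioo a b, R t = 0 := by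
  by_contra! hne
  obtain ⟨t, ht, hRt⟩ := hne
  refine (intervalIntegral.integral_pos hab (hf.continuousOn.mul (hR.pow 2))
    (fun r _ => mul_nonneg (h0 r) (sq_nonneg _)) ⟨t, Ioo_subset_Icc_self ht, ?_⟩).ne' hint
  exact mul_pos (hpos t ht) (sq_pos_of_ne_zero hRt)

lemma exists_Icc_subset_of_isOpen {J : Set ℝ} (hJ : IsOpen J) {t : ℝ} (ht : t ∈ J) :
    ∃ a b, t ∈ Ioo a b ∧ Icc a b ⊆ J := by
  obtain ⟨ε, hε, h⟩ := Metric.nhds_basis_closedBall.mem_iff.1 (hJ.mem_nhds ht)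
  rw [Real.closedBall_eq_Icc] at h
  exact ⟨t - ε, t + ε, ⟨by linarith, by linarith⟩, h⟩

/-- In a geodesic of `N`, the `L²` product of the momentum with every direction `w` in which `N`
can be perturbed linearly is conserved. -/
theorem IsGeodesic.inner_momentum_eq {N : Set (ConeDiff n)} {γ : ℝ → ConeDiff n} {J : Set ℝ}
    (hγ : IsGeodesic μ N γ J) (hJ : IsOpen J) (hJ' : J.OrdConnected)
    {φ₀ : DiffRn n} {F : ℝ → Lp (Rn n) 2 μ} (hF : ContDiffOn ℝ ∞ F J)
    (hFγ : ∀ t ∈ J, F t =ᵐ[μ] fun x => (γ t).1 x - φ₀ x)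
    {w : Rn n → Rn n} (hw : ContDiff ℝ ∞ w) (hwL : MemLp w 2 μ)
    (hpert : ∀ a b, Icc a b ⊆ J → ∃ ε > 0, ∀ t ∈ Icc a b, ∀ σ : ℝ, |σ| < ε →
      ∃ ψ : DiffRn n, (∀ x, ψ x = (γ t).1 x + σ • w x) ∧ (ψ, (γ t).2) ∈ N) :
    ∀ t ∈ J, ∀ t' ∈ J, ((γ t).2 : ℝ) * inner ℝ (deriv F t) (hwL.toLp w)
      = ((γ t').2 : ℝ) * inner ℝ (deriv F t') (hwL.toLp w) := by
  set W := hwL.toLp w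
  have hmsm : ContDiffOn ℝ ∞ (fun r => ((γ r).2 : ℝ)) J := hγ.smooth.2.2
  have hdF : ContDiffOn ℝ ∞ (deriv F) J := hF.deriv_of_isOpen hJ (by simp)
  set p : ℝ → ℝ := fun t => ((γ t).2 : ℝ) * inner ℝ (deriv F t) W with hp
  have hpsm : ContDiffOn ℝ ∞ p J := hmsm.mul (hdF.inner ℝ contDiffOn_const)
  have hdp : ContDiffOn ℝ ∞ (deriv p) J := hpsm.deriv_of_isOpen hJ (by simp)
  have hzero : J.EqOn (deriv p) 0 := fun t₀ ht₀ => by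
    obtain ⟨a, b, hab, hsub⟩ := exists_Icc_subset_of_isOpen hJ ht₀
    have hlt : a < b := hab.1.trans hab.2
    have haJ : a ∈ J := hsub (left_mem_Icc.2 hlt.le)
    have hbJ : b ∈ J := hsub (right_mem_Icc.2 hlt.le)
    obtain ⟨f, hf, hf0, hfpos, hfout⟩ := exists_contDiff_support_eq_Ioo a b
    -- The variation is φ_t + s h(t) w. With this h, integrating the first variation ∫ p h' by parts
    -- leaves -∫ f p'², so criticality forces p' = 0.
    set h : ℝ → ℝ := fun t => f t * deriv p t with hh
    have hhsm : ContDiffOn ℝ ∞ h J := hf.contDiffOn.mul hdp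
    have hhout : ∀ t, t ∉ Ioo a b → h t = 0 := fun t ht => by simp [hh, hfout t ht]
    have ha0 : h a = 0 := hhout a (by simp)
    have hb0 : h b = 0 := hhout b (by simp)
    obtain ⟨C, hC⟩ := isCompact_Icc.exists_bound_of_continuousOn (hhsm.continuousOn.mono hsub)
    have hC0 : 0 ≤ C := (norm_nonneg _).trans (hC t₀ (Ioo_subset_Icc_self hab))
    obtain ⟨ε, hε, hψ⟩ := hpert a b hsub
    -- This keeps |s h(t)| below ε on [a, b]; the added 1 covers C = 0.
    set δ := ε / (C + 1) with hδ
    have hδ0 : 0 < δ := by positivity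
    have h0δ : (0 : ℝ) ∈ Ioo (-δ) δ := ⟨by linarith, hδ0⟩
    have hex : ∀ q ∈ Ioo (-δ) δ ×ˢ J, ∃ ψ : DiffRn n,
        (∀ x, ψ x = (γ q.2).1 x + (q.1 * h q.2) • w x) ∧ (ψ, (γ q.2).2) ∈ N := by
      rintro ⟨s, t⟩ ⟨hs, ht⟩
      by_cases hti : t ∈ Icc a b
      · refine hψ t hti (s * h t) ?_
        have h1 : |h t| ≤ C := hC t hti
        have h2 : |s| < δ := abs_lt.2 hs
        calc |s * h t| = |s| * |h t| := abs_mul _ _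
          _ ≤ |s| * C := by gcongr
          _ ≤ |s| * (C + 1) := by gcongr; linarith
          _ < δ * (C + 1) := by gcongr
          _ = ε := by rw [hδ]; field_simp
      -- A variation must be defined over all of J, but the perturbations are only available on [a,
      -- b]. Elsewhere h vanishes and the curve is left unchanged.
      · have : h t = 0 := hhout t fun h' => hti (Ioo_subset_Icc_self h')
        exact ⟨(γ t).1, fun x => by simp [this], hγ.mem t ht⟩
    have : Nonempty (DiffRn n) := ⟨φ₀⟩
    choose! ψ hψeq hψN using hex
    set Γ : ℝ × ℝ → ConeDiff n := fun q => (ψ q, (γ q.2).2) with hΓ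
    have hzeroΓ : ∀ q ∈ Ioo (-δ) δ ×ˢ J, q.1 * h q.2 = 0 → Γ q = γ q.2 := fun q hq h0 => by
      refine Prod.ext (Diffeomorph.ext fun x => ?_) rfl
      rw [hΓ]
      simp only [hψeq q hq x, h0, zero_smul, add_zero]
    set G : ℝ × ℝ → Lp (Rn n) 2 μ := fun q => F q.2 + (q.1 * h q.2) • W with hG
    have hsnd : MapsTo (Prod.snd : ℝ × ℝ → ℝ) (Ioo (-δ) δ ×ˢ J) J := fun q hq => hq.2
    have hGsm : ContDiffOn ℝ ∞ G (Ioo (-δ) δ ×ˢ J) :=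
      (hF.comp contDiff_snd.contDiffOn hsnd).add
        ((contDiff_fst.contDiffOn.mul (hhsm.comp contDiff_snd.contDiffOn hsnd)).smul
          contDiffOn_const)
    have hGΓ : ∀ q ∈ Ioo (-δ) δ ×ˢ J, G q =ᵐ[μ] fun x => (Γ q).1 x - φ₀ x := fun q hq => by
      filter_upwards [Lp.coeFn_add (F q.2) ((q.1 * h q.2) • W), Lp.coeFn_smul (q.1 * h q.2) W,
        hwL.coeFn_toLp, hFγ q.2 hq.2] with x h1 h2 h3 h4
      rw [hG, hΓ]
      simp only [h1, hψeq q hq x, Pi.add_apply, h2, Pi.smul_apply, h4]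
      rw [h3]
      abel
    have hjoint : ContDiffOn ℝ ∞ (fun q : (ℝ × ℝ) × Rn n => (Γ q.1).1 q.2)
        ((Ioo (-δ) δ ×ˢ J) ×ˢ univ) := by
      have h1 : ContDiffOn ℝ ∞ (fun q : (ℝ × ℝ) × Rn n => (γ q.1.2).1 q.2)
          ((Ioo (-δ) δ ×ˢ J) ×ˢ univ) :=
        hγ.smooth.1.comp (f := fun q : (ℝ × ℝ) × Rn n => (q.1.2, q.2)) (by fun_prop)
          fun q hq => ⟨hq.1.2, mem_univ _⟩
      have h2 : ContDiffOn ℝ ∞ (fun q : (ℝ × ℝ) × Rn n => (q.1.1 * h q.1.2) • w q.2)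
          ((Ioo (-δ) δ ×ˢ J) ×ˢ univ) :=
        ((by fun_prop : ContDiffOn ℝ ∞ (fun q : (ℝ × ℝ) × Rn n => q.1.1) _).mul
          (hhsm.comp (by fun_prop : ContDiffOn ℝ ∞ (fun q : (ℝ × ℝ) × Rn n => q.1.2) _)
            fun q hq => hq.1.2)).smul
          (hw.comp_contDiffOn contDiffOn_snd)
      exact (h1.add h2).congr fun q hq => hψeq q.1 hq.1 q.2
    set M : ℝ × ℝ → ℝ := fun q => ((γ q.2).2 : ℝ) with hM
    have hMsm : ContDiffOn ℝ ∞ M (Ioo (-δ) δ ×ˢ J) :=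
      hmsm.comp contDiff_snd.contDiffOn hsnd
    have hvar : IsVariation μ N γ J a b δ Γ :=
      { smooth := ⟨hjoint, ⟨φ₀, G, hGsm, hGΓ⟩, hMsm⟩
        mem := fun s hs t ht => hψN (s, t) ⟨hs, ht⟩
        base := fun t ht => hzeroΓ (0, t) ⟨h0δ, ht⟩ (by simp)
        left := fun s hs => hzeroΓ (s, a) ⟨hs, haJ⟩ (by simp [ha0])
        right := fun s hs => hzeroΓ (s, b) ⟨hs, hbJ⟩ (by simp [hb0]) }
    have hfirst := (hasDerivAt_energy hδ0 hJ hlt.le hsub hjoint hGsm hGΓ hMsm fun q => rfl).unique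
      (hγ.critical a haJ b hbJ hlt δ hδ0 Γ hvar)
    have hopen : IsOpen (Ioo (-δ) δ ×ˢ J) := isOpen_Ioo.prod hJ
    have hn : ∀ t ∈ J, Ioo (-δ) δ ×ˢ J ∈ 𝓝 ((0 : ℝ), t) := fun t ht => hopen.mem_nhds ⟨h0δ, ht⟩
    have hG1 : ∀ t ∈ J, fderiv ℝ G (0, t) (1, 0) = h t • W := fun t ht => by
      have h1 := hasDerivAt_slice_fst ((hGsm.contDiffAt (hn t ht)).differentiableAt (by simp))
      have h2 : HasDerivAt (fun s : ℝ => F t + (s * h t) • W) ((1 * h t) • W) 0 :=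
        (((hasDerivAt_id (0 : ℝ)).mul_const (h t)).smul_const W).const_add (F t)
      rw [h1.unique h2, one_mul]
    have hG2 : ∀ t ∈ J, fderiv ℝ G (0, t) (0, 1) = deriv F t := fun t ht => by
      rw [← (hasDerivAt_slice_snd ((hGsm.contDiffAt (hn t ht)).differentiableAt (by simp))).deriv]
      congr 1
      ext1 r
      simp [hG]
    have hM1 : ∀ t ∈ J, fderiv ℝ M (0, t) (1, 0) = 0 := fun t ht => by
      rw [← (hasDerivAt_slice_fst ((hMsm.contDiffAt (hn t ht)).differentiableAt (by simp))).deriv]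
      simp [hM]
    have hdh : ∀ t ∈ J, HasDerivAt h (deriv h t) t := fun t ht =>
      ((hhsm.contDiffAt (hJ.mem_nhds ht)).differentiableAt (by simp)).hasDerivAt
    have hint : ∫ t in a..b, p t * deriv h t = 0 := by
      rw [← hfirst]
      refine intervalIntegral.integral_congr fun t ht => ?_
      rw [uIcc_of_le hlt.le] at ht
      have htJ := hsub ht
      have e1 : deriv (fun r => fderiv ℝ G (0, r) (1, 0)) t = deriv h t • W := by
        rw [Filter.EventuallyEq.deriv_eq (f := fun r => h r • W) (by
          filter_upwards [hJ.mem_nhds htJ] with r hr using hG1 r hr)]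
        exact ((hdh t htJ).smul_const W).deriv
      have e2 : deriv (fun r => fderiv ℝ M (0, r) (1, 0)) t = 0 := by
        rw [Filter.EventuallyEq.deriv_eq (f := fun r => (0 : ℝ)) (by
          filter_upwards [hJ.mem_nhds htJ] with r hr using hM1 r hr)]
        simp
      have e3 : M (0, t) = ((γ t).2 : ℝ) := rfl
      simp only [hM1 t htJ, hG2 t htJ, e1, e2, e3, real_inner_smul_right, hp]
      ring
    have hint' : ∫ t in a..b, f t * deriv p t ^ 2 = 0 := by
      have hparts := intervalIntegral.integral_mul_deriv_eq_deriv_mul (a := a) (b := b)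
        (u := p) (v := h) (u' := deriv p) (v' := deriv h)
        (fun t ht => by
          rw [uIcc_of_le hlt.le] at ht
          exact ((hpsm.contDiffAt (hJ.mem_nhds (hsub ht))).differentiableAt (by simp)).hasDerivAt)
        (fun t ht => by rw [uIcc_of_le hlt.le] at ht; exact hdh t (hsub ht))
        (ContinuousOn.intervalIntegrable (by
          rw [uIcc_of_le hlt.le]; exact hdp.continuousOn.mono hsub))
        (ContinuousOn.intervalIntegrable (by
          rw [uIcc_of_le hlt.le]
          exact (hhsm.continuousOn_deriv_of_isOpen hJ (by simp)).mono hsub))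
      rw [hint, ha0, hb0, mul_zero, mul_zero, sub_zero, zero_sub, eq_comm, neg_eq_zero] at hparts
      rw [← hparts]
      congr 1
      ext t
      simp only [hh]
      ring
    exact eq_zero_of_integral_mul_sq_eq_zero hlt hf.continuous hf0 hfpos
      (hdp.continuousOn.mono hsub) hint' t₀ hab
  intro t ht t' ht'
  exact hJ.is_const_of_deriv_eq_zero hJ'.isPreconnected
    (hpsm.differentiableOn (by simp)) hzero ht ht'

/-- The mass equation holds for geodesics of every `N` that is stable under changes of mass. -/
theorem IsGeodesic.mass_equation {N : Set (ConeDiff n)} {γ : ℝ → ConeDiff n} {J : Set ℝ}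
    (hγ : IsGeodesic μ N γ J) (hJ : IsOpen J)
    (hN : ∀ p ∈ N, ∀ m : PosReal, (p.1, m) ∈ N) :
    ∀ t ∈ J, deriv (deriv fun r => ((γ r).2 : ℝ)) t =
      1 / 2 * uotMetric μ (γ t) (velocity γ t) (velocity γ t) := by
  obtain ⟨hγjoint, ⟨φ₀, F, hF, hFγ⟩, hmsm⟩ := hγ.smooth
  set m : ℝ → ℝ := fun r => ((γ r).2 : ℝ) with hm
  have hmpos : ∀ t, 0 < m t := fun t => (γ t).2.2
  have hdF : ContDiffOn ℝ ∞ (deriv F) J := hF.deriv_of_isOpen hJ (by simp)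
  have hdm : ContDiffOn ℝ ∞ (deriv m) J := hmsm.deriv_of_isOpen hJ (by simp)
  have hddm : ContDiffOn ℝ ∞ (deriv (deriv m)) J := hdm.deriv_of_isOpen hJ (by simp)
  -- R is the defect of the mass equation; the variation below is built from R itself.
  set R : ℝ → ℝ := fun t => 1 / 2 * (m t * inner ℝ (deriv F t) (deriv F t)
    + deriv m t * deriv m t / m t) - deriv (deriv m) t with hR
  have hRsm : ContDiffOn ℝ ∞ R J :=
    (contDiffOn_const.mul ((hmsm.mul (hdF.inner ℝ hdF)).add
      ((hdm.mul hdm).div hmsm fun t _ => (hmpos t).ne'))).sub hddm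
  suffices hzero : ∀ t ∈ J, R t = 0 by
    intro t ht
    have hv := deriv_displacement_ae_eq hJ hγjoint hFγ ht
      ((hF.contDiffAt (hJ.mem_nhds ht)).differentiableAt (by simp)).hasDerivAt
    rw [uotMetric_eq_inner hv hv]
    exact (sub_eq_zero.1 (hzero t ht)).symm
  intro t₀ ht₀
  obtain ⟨a, b, hab, hsub⟩ := exists_Icc_subset_of_isOpen hJ ht₀
  have hlt : a < b := hab.1.trans hab.2
  have haJ : a ∈ J := hsub (left_mem_Icc.2 hlt.le)
  have hbJ : b ∈ J := hsub (right_mem_Icc.2 hlt.le)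
  obtain ⟨f, hf, hf0, hfpos, hfout⟩ := exists_contDiff_support_eq_Ioo a b
  set h : ℝ → ℝ := fun t => f t * R t with hh
  have hhsm : ContDiffOn ℝ ∞ h J := hf.contDiffOn.mul hRsm
  have ha0 : h a = 0 := by simp [hh, hfout a (by simp)]
  have hb0 : h b = 0 := by simp [hh, hfout b (by simp)]
  have h01 : (0 : ℝ) ∈ Ioo (-1 : ℝ) 1 := by simp
  -- Varying the mass by the factor exp(s h) keeps it positive for every s, so δ = 1 serves.
  set Γ : ℝ × ℝ → ConeDiff n := fun q =>
    ((γ q.2).1, ⟨m q.2 * Real.exp (q.1 * h q.2), mul_pos (hmpos _) (Real.exp_pos _)⟩) with hΓ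
  have hzeroΓ : ∀ q : ℝ × ℝ, q.1 * h q.2 = 0 → Γ q = γ q.2 := fun q h0 =>
    Prod.ext rfl (Subtype.ext (by simp [hΓ, h0, hm]))
  have hsnd : MapsTo (Prod.snd : ℝ × ℝ → ℝ) (Ioo (-1) 1 ×ˢ J) J := fun q hq => hq.2
  set G : ℝ × ℝ → Lp (Rn n) 2 μ := fun q => F q.2 with hG
  have hGsm : ContDiffOn ℝ ∞ G (Ioo (-1) 1 ×ˢ J) := hF.comp contDiff_snd.contDiffOn hsnd
  have hGΓ : ∀ q ∈ Ioo (-1 : ℝ) 1 ×ˢ J, G q =ᵐ[μ] fun x => (Γ q).1 x - φ₀ x := fun q hq =>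
    hFγ q.2 hq.2
  have hjoint : ContDiffOn ℝ ∞ (fun q : (ℝ × ℝ) × Rn n => (Γ q.1).1 q.2)
      ((Ioo (-1) 1 ×ˢ J) ×ˢ univ) :=
    hγ.smooth.1.comp (f := fun q : (ℝ × ℝ) × Rn n => (q.1.2, q.2)) (by fun_prop)
      fun q hq => ⟨hq.1.2, mem_univ _⟩
  set M : ℝ × ℝ → ℝ := fun q => m q.2 * Real.exp (q.1 * h q.2) with hM
  have hMsm : ContDiffOn ℝ ∞ M (Ioo (-1) 1 ×ˢ J) :=
    (hmsm.comp contDiff_snd.contDiffOn hsnd).mul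
      (contDiff_fst.contDiffOn.mul (hhsm.comp contDiff_snd.contDiffOn hsnd)).exp
  have hvar : IsVariation μ N γ J a b 1 Γ :=
    { smooth := ⟨hjoint, ⟨φ₀, G, hGsm, hGΓ⟩, hMsm⟩
      mem := fun s _ t ht => hN (γ t) (hγ.mem t ht) _
      base := fun t _ => hzeroΓ (0, t) (by simp)
      left := fun s _ => hzeroΓ (s, a) (by simp [ha0])
      right := fun s _ => hzeroΓ (s, b) (by simp [hb0]) }
  have hfirst := (hasDerivAt_energy one_pos hJ hlt.le hsub hjoint hGsm hGΓ hMsm fun q => rfl).unique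
    (hγ.critical a haJ b hbJ hlt 1 one_pos Γ hvar)
  have hopen : IsOpen (Ioo (-1 : ℝ) 1 ×ˢ J) := isOpen_Ioo.prod hJ
  have hn : ∀ t ∈ J, Ioo (-1 : ℝ) 1 ×ˢ J ∈ 𝓝 ((0 : ℝ), t) := fun t ht =>
    hopen.mem_nhds ⟨h01, ht⟩
  have hd : ∀ {u : ℝ → ℝ}, ContDiffOn ℝ ∞ u J → ∀ t ∈ J, HasDerivAt u (deriv u t) t :=
    fun hu t ht => ((hu.contDiffAt (hJ.mem_nhds ht)).differentiableAt (by simp)).hasDerivAt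
  have hG1 : ∀ t ∈ J, fderiv ℝ G (0, t) (1, 0) = 0 := fun t ht => by
    rw [← (hasDerivAt_slice_fst ((hGsm.contDiffAt (hn t ht)).differentiableAt (by simp))).deriv]
    simp [hG]
  have hG2 : ∀ t ∈ J, fderiv ℝ G (0, t) (0, 1) = deriv F t := fun t ht =>
    (hasDerivAt_slice_snd ((hGsm.contDiffAt (hn t ht)).differentiableAt (by simp))).deriv.symm
  have hM1 : ∀ t ∈ J, fderiv ℝ M (0, t) (1, 0) = m t * h t := fun t ht => by
    have h1 := hasDerivAt_slice_fst ((hMsm.contDiffAt (hn t ht)).differentiableAt (by simp))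
    have h2 : HasDerivAt (fun s : ℝ => m t * Real.exp (s * h t))
        (m t * (Real.exp (0 * h t) * (1 * h t))) 0 :=
      (((hasDerivAt_id (0 : ℝ)).mul_const (h t)).exp).const_mul (m t)
    rw [h1.unique h2]
    simp
  have hM2 : ∀ t ∈ J, fderiv ℝ M (0, t) (0, 1) = deriv m t := fun t ht => by
    rw [← (hasDerivAt_slice_snd ((hMsm.contDiffAt (hn t ht)).differentiableAt (by simp))).deriv]
    congr 1
    ext1 r
    simp [hM]
  -- The mass varies in the direction m h, so the integrand is h R + (ṁ h)'. The second term
  -- integrates to zero because h vanishes at the ends.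
  have hint : ∫ t in a..b, (f t * R t ^ 2 + deriv (fun r => deriv m r * h r) t) = 0 := by
    rw [← hfirst]
    refine intervalIntegral.integral_congr fun t ht => ?_
    rw [uIcc_of_le hlt.le] at ht
    have htJ := hsub ht
    have e1 : deriv (fun r => fderiv ℝ G (0, r) (1, 0)) t = 0 := by
      rw [Filter.EventuallyEq.deriv_eq (f := fun r => (0 : Lp (Rn n) 2 μ)) (by
        filter_upwards [hJ.mem_nhds htJ] with r hr using hG1 r hr)]
      simp
    have e2 : deriv (fun r => fderiv ℝ M (0, r) (1, 0)) t = deriv m t * h t + m t * deriv h t := by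
      rw [Filter.EventuallyEq.deriv_eq (f := fun r => m r * h r) (by
        filter_upwards [hJ.mem_nhds htJ] with r hr using hM1 r hr)]
      exact ((hd hmsm t htJ).mul (hd hhsm t htJ)).deriv
    have e3 : deriv (fun r => deriv m r * h r) t
        = deriv (deriv m) t * h t + deriv m t * deriv h t :=
      ((hd hdm t htJ).mul (hd hhsm t htJ)).deriv
    have e4 : M (0, t) = m t := by simp [hM]
    have e5 : f t * R t ^ 2 = h t * R t := by simp only [hh]; ring
    have hne := (hmpos t).ne'
    simp only [hM1 t htJ, hM2 t htJ, hG2 t htJ, e1, e2, e3, e4, e5, inner_zero_right]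
    simp only [hR]
    field_simp
    ring
  have hprod : ContDiffOn ℝ ∞ (fun r => deriv m r * h r) J := hdm.mul hhsm
  have hprodint : IntervalIntegrable (deriv fun r => deriv m r * h r) volume a b :=
    ContinuousOn.intervalIntegrable (by
      rw [uIcc_of_le hlt.le]
      exact (hprod.continuousOn_deriv_of_isOpen hJ (by simp)).mono hsub)
  rw [intervalIntegral.integral_add (ContinuousOn.intervalIntegrable (by
      rw [uIcc_of_le hlt.le]
      exact hf.continuous.continuousOn.mul ((hRsm.continuousOn.mono hsub).pow 2))) hprodint,
    intervalIntegral.integral_deriv_eq_sub (fun t ht => by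
      rw [uIcc_of_le hlt.le] at ht
      exact (hd hprod t (hsub ht)).differentiableAt) hprodint, ha0, hb0, mul_zero, mul_zero,
    sub_zero, add_zero] at hint
  exact eq_zero_of_integral_mul_sq_eq_zero hlt hf.continuous hf0 hfpos
    (hRsm.continuousOn.mono hsub) hint t₀ hab

/-! ### Perturbing a diffeomorphism by a vector field -/

section Perturbation

lemma contDiff_diffeo (φ : DiffRn n) : ContDiff ℝ ∞ φ := φ.contMDiff.contDiff

lemma hasFDerivAt_diffeo (φ : DiffRn n) (x : Rn n) : HasFDerivAt φ (fderiv ℝ φ x) x :=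
  ((contDiff_diffeo φ).differentiable (by simp) x).hasFDerivAt

lemma fderiv_symm_comp_fderiv (φ : DiffRn n) (x : Rn n) :
    (fderiv ℝ φ.symm (φ x)).comp (fderiv ℝ φ x) = ContinuousLinearMap.id ℝ (Rn n) := by
  refine ((hasFDerivAt_diffeo φ.symm (φ x)).comp x (hasFDerivAt_diffeo φ x)).unique ?_
  refine (hasFDerivAt_id x).congr_of_eventuallyEq (Eventually.of_forall fun y => ?_)
  simp

lemma fderiv_comp_fderiv_symm (φ : DiffRn n) (x : Rn n) :
    (fderiv ℝ φ x).comp (fderiv ℝ φ.symm (φ x)) = ContinuousLinearMap.id ℝ (Rn n) := by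
  have h := fderiv_symm_comp_fderiv φ.symm (φ x)
  rwa [Diffeomorph.symm_apply_apply] at h

/-- Factor φ + σ w = (id + σ w ∘ φ⁻¹) ∘ φ. The hypothesis bounds the derivative of w ∘ φ⁻¹ at φ(x),
so the first factor is a contractive perturbation of the identity. -/
lemma exists_diffeo_add_smul (φ : DiffRn n) {w : Rn n → Rn n} (hw : ContDiff ℝ ∞ w) {C : ℝ}
    (hC : ∀ x, ‖(fderiv ℝ w x).comp (fderiv ℝ φ.symm (φ x))‖ ≤ C) {σ : ℝ} (hσ : |σ| * C < 1) :
    ∃ ψ : DiffRn n, ∀ x, ψ x = φ x + σ • w x := by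
  have hC0 : 0 ≤ C := (norm_nonneg _).trans (hC 0)
  have hg : ContDiff ℝ ∞ fun y => σ • w (φ.symm y) :=
    (hw.comp (contDiff_diffeo φ.symm)).const_smul σ
  have hbound : ∀ y, ‖fderiv ℝ (fun y => σ • w (φ.symm y)) y‖₊
      ≤ (|σ| * C).toNNReal := fun y => by
    have h1 : HasFDerivAt (fun y => σ • w (φ.symm y))
        (σ • (fderiv ℝ w (φ.symm y)).comp (fderiv ℝ φ.symm y)) y :=
      (((hw.differentiable (by simp) _).hasFDerivAt).comp y
        (hasFDerivAt_diffeo φ.symm y)).const_smul σ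
    have h2 := hC (φ.symm y)
    rw [Diffeomorph.apply_symm_apply] at h2
    rw [h1.fderiv, ← NNReal.coe_le_coe, coe_nnnorm, norm_smul, Real.norm_eq_abs,
      Real.coe_toNNReal _ (by positivity)]
    exact mul_le_mul_of_nonneg_left h2 (abs_nonneg σ)
  obtain ⟨ψ, hψ⟩ := exists_diffeomorph_id_add hg (Real.toNNReal_lt_one.2 hσ) hbound
  exact ⟨φ.trans ψ, fun x => by simp [hψ]⟩

/-- The inverse derivatives of a smooth family of diffeomorphisms are bounded on compact sets. -/
lemma exists_bound_fderiv_symm {γ : ℝ → ConeDiff n} {J : Set ℝ} (hJ : IsOpen J)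
    (h : ContDiffOn ℝ ∞ (fun q : ℝ × Rn n => (γ q.1).1 q.2) (J ×ˢ univ)) {a b : ℝ}
    (hsub : Icc a b ⊆ J) {K : Set (Rn n)} (hK : IsCompact K) :
    ∃ C, 0 ≤ C ∧ ∀ t ∈ Icc a b, ∀ x ∈ K, ‖fderiv ℝ (γ t).1.symm ((γ t).1 x)‖ ≤ C := by
  have hopen : IsOpen (J ×ˢ (univ : Set (Rn n))) := hJ.prod isOpen_univ
  have hA : ContinuousOn (fun q : ℝ × Rn n => fderiv ℝ (γ q.1).1 q.2) (J ×ˢ univ) := by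
    have h1 : ContinuousOn (fun q => (fderiv ℝ (fun q : ℝ × Rn n => (γ q.1).1 q.2) q).comp
        (ContinuousLinearMap.inr ℝ ℝ (Rn n))) (J ×ˢ univ) :=
      (h.continuousOn_fderiv_of_isOpen hopen (by simp)).clm_comp continuousOn_const
    refine h1.congr fun q hq => ?_
    have hd : DifferentiableAt ℝ (fun q : ℝ × Rn n => (γ q.1).1 q.2) (q.1, q.2) :=
      (h.contDiffAt (hopen.mem_nhds hq)).differentiableAt (by simp)
    exact (hd.hasFDerivAt.comp q.2 (hasFDerivAt_prodMk_right q.1 q.2)).fderiv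
  have hinv : ContinuousOn (fun q : ℝ × Rn n => fderiv ℝ (γ q.1).1.symm ((γ q.1).1 q.2))
      (J ×ˢ univ) := by
    intro q hq
    -- The derivative of φ_t⁻¹ at φ_t(x) is the inverse operator of φ_t'(x), and inversion is
    -- continuous at units. Joint regularity of (t, y) ↦ φ_t⁻¹(y) is thus not needed.
    let U : ∀ q : ℝ × Rn n, (Rn n →L[ℝ] Rn n)ˣ := fun q =>
      ⟨fderiv ℝ (γ q.1).1 q.2, fderiv ℝ (γ q.1).1.symm ((γ q.1).1 q.2),
        fderiv_comp_fderiv_symm _ _, fderiv_symm_comp_fderiv _ _⟩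
    have h2 := (NormedRing.inverse_continuousAt (U q)).comp_continuousWithinAt
      (f := fun q : ℝ × Rn n => fderiv ℝ (γ q.1).1 q.2) (hA q hq)
    refine h2.congr (fun r _ => ?_) ?_
    · exact (Ring.inverse_unit (U r)).symm
    · exact (Ring.inverse_unit (U q)).symm
  obtain ⟨C, hC⟩ := (isCompact_Icc.prod hK).exists_bound_of_continuousOn
    (hinv.mono (prod_mono hsub (subset_univ K)))
  exact ⟨max C 0, le_max_right _ _, fun t ht x hx => (hC (t, x) ⟨ht, hx⟩).trans (le_max_left _ _)⟩

end Perturbation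

/-! ### Linear diffeomorphisms and the submanifold property -/

section Linear

lemma exists_clm_of_isLinearMap {f : Rn n → Rn n} (hf : IsLinearMap ℝ f) :
    ∃ T : Rn n →L[ℝ] Rn n, ∀ x, T x = f x :=
  ⟨(hf.mk' f).toContinuousLinearMap, fun _ => rfl⟩

lemma isLinearMap_linearMap (X : Matrix (Fin n) (Fin n) ℝ) : IsLinearMap ℝ (linearMap X) :=
  (Matrix.toEuclideanCLM (𝕜 := ℝ) X).toLinearMap.isLinear

lemma isLinearMap_symm {φ : DiffRn n} (h : IsLinearMap ℝ φ) : IsLinearMap ℝ φ.symm where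
  map_add x y := φ.injective (by simp [h.map_add])
  map_smul c x := φ.injective (by simp [h.map_smul])

/-- The image of `GL(n) × ℝ₊` consists of the diffeomorphisms that are linear. -/
lemma mem_range_inclusion_iff {p : ConeDiff n} :
    p ∈ range (inclusion (n := n)) ↔ IsLinearMap ℝ p.1 := by
  constructor
  · rintro ⟨q, rfl⟩
    exact isLinearMap_linearMap _
  · intro h
    obtain ⟨T, hT⟩ := exists_clm_of_isLinearMap h
    obtain ⟨S, hS⟩ := exists_clm_of_isLinearMap (isLinearMap_symm h)
    have hTS : T * S = 1 := by
      ext1 x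
      change T (S x) = x
      rw [hT, hS, Diffeomorph.apply_symm_apply]
    have hST : S * T = 1 := by
      ext1 x
      change S (T x) = x
      rw [hT, hS, Diffeomorph.symm_apply_apply]
    let e := Matrix.toEuclideanCLM (n := Fin n) (𝕜 := ℝ)
    refine ⟨(⟨e.symm T, e.symm S, by rw [← map_mul, hTS, map_one],
      by rw [← map_mul, hST, map_one]⟩, p.2), Prod.ext (Diffeomorph.ext fun x => ?_) rfl⟩
    change e (e.symm T) x = p.1 x
    rw [StarAlgEquiv.apply_symm_apply, hT]

lemma isLinearMap_velocity {γ : ℝ → ConeDiff n} {J : Set ℝ} (hJ : IsOpen J)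
    (h : ContDiffOn ℝ ∞ (fun q : ℝ × Rn n => (γ q.1).1 q.2) (J ×ˢ univ))
    (hlin : ∀ t ∈ J, IsLinearMap ℝ (γ t).1) {t : ℝ} (ht : t ∈ J) :
    IsLinearMap ℝ (velocity γ t).1 where
  map_add x y := by
    refine (hasDerivAt_apply hJ h ht (x + y)).unique
      (((hasDerivAt_apply hJ h ht x).add (hasDerivAt_apply hJ h ht y)).congr_of_eventuallyEq ?_)
    filter_upwards [hJ.mem_nhds ht] with s hs using (hlin s hs).map_add x y
  map_smul c x := by
    refine (hasDerivAt_apply hJ h ht (c • x)).unique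
      (((hasDerivAt_apply hJ h ht x).const_smul c).congr_of_eventuallyEq ?_)
    filter_upwards [hJ.mem_nhds ht] with s hs using (hlin s hs).map_smul c x

/-- A smooth family of linear maps is a smooth family of diffeomorphisms. -/
lemma smoothFamily_of_clm (hμ : MemLp id 2 μ) {P : Type*} [NormedAddCommGroup P]
    [NormedSpace ℝ P] {f : P → ConeDiff n} {U : Set P} {T : P → Rn n →L[ℝ] Rn n}
    (hT : ContDiffOn ℝ ∞ T U) (hfT : ∀ u ∈ U, ∀ x, (f u).1 x = T u x)
    (hm : ContDiffOn ℝ ∞ (fun u => ((f u).2 : ℝ)) U) : SmoothFamily μ f U := by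
  refine ⟨?_, ⟨Diffeomorph.refl _ _ _, ?_⟩, hm⟩
  · have h1 : ContDiffOn ℝ ∞ (fun q : P × Rn n => T q.1 q.2) (U ×ˢ univ) :=
      (hT.comp contDiffOn_fst fun q hq => hq.1).clm_apply contDiffOn_snd
    exact h1.congr fun q hq => hfT q.1 hq.1 q.2
  -- Its domain is finite-dimensional, so this linear map into L² is automatically continuous, hence
  -- smooth.
  · let L : (Rn n →L[ℝ] Rn n) →ₗ[ℝ] Lp (Rn n) 2 μ :=
      { toFun := fun S => (memLp_continuousLinearMap hμ S).toLp S
        map_add' := fun _ _ => rfl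
        map_smul' := fun _ _ => rfl }
    refine ⟨fun u => L.toContinuousLinearMap (T u - ContinuousLinearMap.id ℝ (Rn n)),
      L.toContinuousLinearMap.contDiff.comp_contDiffOn (hT.sub contDiffOn_const), fun u hu => ?_⟩
    refine (MemLp.coeFn_toLp (memLp_continuousLinearMap hμ
      (T u - ContinuousLinearMap.id ℝ (Rn n)))).trans (Eventually.of_forall fun x => ?_)
    simp [hfT u hu x]

end Linear

theorem inclusionIsSubmanifold (hμ : MemLp id 2 μ) : InclusionIsSubmanifold μ := by
  refine ⟨fun p q h => ?_, fun k U hU f => ⟨fun hf => ?_, fun hf => ⟨fun i j => ?_, hf.2.2⟩⟩⟩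
  · have h1 : ∀ x, linearMap (p.1 : Matrix (Fin n) (Fin n) ℝ) x = linearMap q.1 x := fun x =>
      congrArg (fun r : ConeDiff n => r.1 x) h
    refine Prod.ext (Units.ext ?_) (congrArg Prod.snd h :)
    refine (Matrix.toEuclideanCLM (n := Fin n) (𝕜 := ℝ)).injective ?_
    ext1 x
    exact h1 x
  · refine smoothFamily_of_clm hμ
      (T := fun u => Matrix.toEuclideanCLM (𝕜 := ℝ) ((f u).1 : Matrix (Fin n) (Fin n) ℝ)) ?_
      (fun u _ x => rfl) hf.2
    rw [contDiffOn_clm_apply]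
    intro x
    rw [contDiffOn_euclidean]
    intro i
    change ContDiffOn ℝ ∞ (fun u => ∑ j, ((f u).1 : Matrix (Fin n) (Fin n) ℝ) i j * x j) U
    exact ContDiffOn.sum fun j _ => (hf.1 i j).mul contDiffOn_const
  -- Matrix entries are recovered by evaluating at the basis vectors, so joint smoothness in (u, x)
  -- suffices.
  · have h1 : ContDiffOn ℝ ∞ (fun u => (inclusion (f u)).1 (EuclideanSpace.single j 1)) U :=
      hf.1.comp (f := fun u => (u, EuclideanSpace.single j (1 : ℝ))) (by fun_prop)
        fun u hu => ⟨hu, mem_univ _⟩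
    have h2 := contDiffOn_euclidean.1 h1 i
    refine h2.congr fun u _ => ?_
    change _ = (((f u).1 : Matrix (Fin n) (Fin n) ℝ).mulVec (Pi.single j 1)) i
    simp

/-! ### The geodesic equations in GL(n) × ℝ₊ and in Diff(ℝⁿ) × ℝ₊ -/

section Equations

variable {γ : ℝ → ConeDiff n} {J : Set ℝ}

/-- The conservation law of `IsGeodesic.inner_momentum_eq`, carried back from L² classes to the
pointwise velocities. -/
lemma inner_toLp_sub_eq_zero [IsFiniteMeasureOnCompacts μ] {N : Set (ConeDiff n)}
    (hγ : IsGeodesic μ N γ J) (hJ : IsOpen J) (hJ' : J.OrdConnected)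
    {w : Rn n → Rn n} (hw : ContDiff ℝ ∞ w) (hwL : MemLp w 2 μ)
    (hpert : ∀ a b, Icc a b ⊆ J → ∃ ε > 0, ∀ t ∈ Icc a b, ∀ σ : ℝ, |σ| < ε →
      ∃ ψ : DiffRn n, (∀ x, ψ x = (γ t).1 x + σ • w x) ∧ (ψ, (γ t).2) ∈ N)
    {t t' : ℝ} (ht : t ∈ J) (ht' : t' ∈ J) :
    ∫ x, inner ℝ (((γ t).2 : ℝ) • (velocity γ t).1 x - ((γ t').2 : ℝ) • (velocity γ t').1 x)
      (w x) ∂μ = 0 := by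
  obtain ⟨hjoint, ⟨φ₀, F, hF, hFγ⟩, hm⟩ := hγ.smooth
  have hv : ∀ t ∈ J, ⇑(deriv F t) =ᵐ[μ] (velocity γ t).1 := fun t ht =>
    deriv_displacement_ae_eq hJ hjoint hFγ ht
      ((hF.contDiffAt (hJ.mem_nhds ht)).differentiableAt (by simp)).hasDerivAt
  have h := hγ.inner_momentum_eq hJ hJ' hF hFγ hw hwL hpert t ht t' ht'
  rw [← real_inner_smul_left, ← real_inner_smul_left, ← sub_eq_zero, ← inner_sub_left,
    L2.inner_def] at h
  refine (integral_congr_ae ?_).trans h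
  filter_upwards [hv t ht, hv t' ht', hwL.coeFn_toLp,
    Lp.coeFn_sub (((γ t).2 : ℝ) • deriv F t) (((γ t').2 : ℝ) • deriv F t'),
    Lp.coeFn_smul ((γ t).2 : ℝ) (deriv F t), Lp.coeFn_smul ((γ t').2 : ℝ) (deriv F t')]
    with x h1 h2 h3 h4 h5 h6
  rw [h3, h4, Pi.sub_apply, h5, h6, Pi.smul_apply, Pi.smul_apply, h1, h2]

/-- Geodesics of `GL(n) × ℝ₊` satisfy the ambient geodesic equations. -/
theorem geodesicEquations_of_linear [IsFiniteMeasure μ] [μ.IsOpenPosMeasure] (hμ : MemLp id 2 μ)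
    (hJ : IsOpen J) (hJ' : J.OrdConnected)
    (hγ : IsGeodesic μ (range (inclusion (n := n))) γ J) : GeodesicEquations μ γ J := by
  refine ⟨fun t ht t' ht' => ?_, hγ.mass_equation hJ fun p hp m => ?_⟩
  · have hlin : ∀ t ∈ J, IsLinearMap ℝ (γ t).1 := fun t ht =>
      mem_range_inclusion_iff.1 (hγ.mem t ht)
    obtain ⟨V, hV⟩ := exists_clm_of_isLinearMap (isLinearMap_velocity hJ hγ.smooth.1 hlin ht)
    obtain ⟨V', hV'⟩ := exists_clm_of_isLinearMap (isLinearMap_velocity hJ hγ.smooth.1 hlin ht')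
    -- The momentum difference is linear, hence an admissible direction in GL(n); testing it against
    -- itself gives ∫ |w|² dμ = 0.
    set w : Rn n →L[ℝ] Rn n := ((γ t).2 : ℝ) • V - ((γ t').2 : ℝ) • V' with hwdef
    have hwx : ∀ x, w x = ((γ t).2 : ℝ) • (velocity γ t).1 x
        - ((γ t').2 : ℝ) • (velocity γ t').1 x := fun x => by simp [hwdef, hV, hV']
    have hwL := memLp_continuousLinearMap hμ w
    have hint := inner_toLp_sub_eq_zero hγ hJ hJ' w.contDiff hwL (fun a b hsub => by
      -- The inverses are linear, so their derivatives are constant in space and a bound at the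
      -- origin is enough.
      obtain ⟨C, hC0, hC⟩ := exists_bound_fderiv_symm hJ hγ.smooth.1 hsub
        (isCompact_singleton (x := (0 : Rn n)))
      refine ⟨1 / (‖w‖ * C + 1), by positivity, fun s hs σ hσ => ?_⟩
      have hbound : ∀ x, ‖(fderiv ℝ w x).comp
          (fderiv ℝ (γ s).1.symm ((γ s).1 x))‖ ≤ ‖w‖ * C := fun x => by
        obtain ⟨S, hS⟩ := exists_clm_of_isLinearMap (isLinearMap_symm (hlin s (hsub hs)))
        have hS' : ((γ s).1.symm : Rn n → Rn n) = S := funext fun y => (hS y).symm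
        have h0 := hC s hs 0 rfl
        rw [hS', S.fderiv] at h0 ⊢
        rw [w.fderiv]
        exact (w.opNorm_comp_le S).trans (by gcongr)
      obtain ⟨ψ, hψ⟩ := exists_diffeo_add_smul (γ s).1 w.contDiff hbound (σ := σ) (by
        rw [lt_div_iff₀ (by positivity)] at hσ
        nlinarith [abs_nonneg σ])
      refine ⟨ψ, hψ, mem_range_inclusion_iff.2 ⟨fun x y => ?_, fun c x => ?_⟩⟩
      · simp only [hψ, (hlin s (hsub hs)).map_add, map_add, smul_add]
        abel
      · simp only [hψ, (hlin s (hsub hs)).map_smul, map_smul, smul_add, smul_comm σ c]) ht ht'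
    simp only [← hwx] at hint
    have hint' : Integrable (fun x => (inner ℝ (w x) (w x) : ℝ)) μ := by
      simpa only [real_inner_self_eq_norm_sq] using
        (memLp_two_iff_integrable_sq_norm hwL.1).1 hwL
    have hae : (fun x => (inner ℝ (w x) (w x) : ℝ)) =ᵐ[μ] 0 :=
      (integral_eq_zero_iff_of_nonneg (fun x => real_inner_self_nonneg) hint').1 hint
    have heq := (Continuous.ae_eq_iff_eq μ (by fun_prop) continuous_const).1 hae
    intro x
    have := congrFun heq x
    rw [← sub_eq_zero, ← hwx]
    exact inner_self_eq_zero.1 this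
  · exact mem_range_inclusion_iff.2 (mem_range_inclusion_iff (p := p).1 hp)

/-- Geodesics of `Diff(ℝⁿ) × ℝ₊` satisfy the geodesic equations. -/
theorem geodesicEquations_of_ambient [IsFiniteMeasure μ] [μ.IsOpenPosMeasure]
    (hJ : IsOpen J) (hJ' : J.OrdConnected) (hγ : IsGeodesic μ univ γ J) :
    GeodesicEquations μ γ J := by
  refine ⟨fun t ht t' ht' => ?_, hγ.mass_equation hJ fun p hp m => mem_univ _⟩
  set d : Rn n → Rn n := fun x => ((γ t).2 : ℝ) • (velocity γ t).1 x
    - ((γ t').2 : ℝ) • (velocity γ t').1 x with hd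
  have hdc : Continuous d :=
    ((continuous_velocity hJ hγ.smooth.1 ht).const_smul ((γ t).2 : ℝ)).sub
      ((continuous_velocity hJ hγ.smooth.1 ht').const_smul ((γ t').2 : ℝ))
  have hzero : ∀ v x, (inner ℝ (d x) v : ℝ) = 0 := fun v => by
    have hc : Continuous fun x => (inner ℝ (d x) v : ℝ) := hdc.inner continuous_const
    have hae : ∀ᵐ x ∂μ, (inner ℝ (d x) v : ℝ) = 0 := by
      refine ae_eq_zero_of_integral_contDiff_smul_eq_zero hc.locallyIntegrable fun η hη hηc => ?_
      have hw : ContDiff ℝ ∞ fun x => η x • v := hη.smul contDiff_const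
      have hwc : HasCompactSupport fun x => η x • v := hηc.smul_right
      have hint := inner_toLp_sub_eq_zero hγ hJ hJ' hw
        (hw.continuous.memLp_of_hasCompactSupport hwc) (fun a b hsub => by
          obtain ⟨C, hC0, hC⟩ := exists_bound_fderiv_symm hJ hγ.smooth.1 hsub hwc.isCompact
          obtain ⟨D, hD⟩ := (hwc.fderiv ℝ).exists_bound_of_continuous
            (hw.continuous_fderiv (by simp))
          have hD0 : 0 ≤ D := (norm_nonneg _).trans (hD 0)
          refine ⟨1 / (D * C + 1), by positivity, fun s hs σ hσ => ?_⟩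
          -- The inverse derivatives are controlled only on the compact support of the field; off it
          -- the derivative of the field vanishes.
          have hbound : ∀ x, ‖(fderiv ℝ (fun x => η x • v) x).comp
              (fderiv ℝ (γ s).1.symm ((γ s).1 x))‖ ≤ D * C := fun x => by
            by_cases hx : x ∈ tsupport fun x => η x • v
            · exact (ContinuousLinearMap.opNorm_comp_le _ _).trans
                (mul_le_mul (hD x) (hC s hs x hx) (norm_nonneg _) hD0)
            · have h0 : fderiv ℝ (fun x => η x • v) x = 0 := by
                by_contra hne
                exact hx (support_fderiv_subset ℝ hne)
              rw [h0, ContinuousLinearMap.zero_comp, norm_zero]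
              positivity
          obtain ⟨ψ, hψ⟩ := exists_diffeo_add_smul (γ s).1 hw hbound (σ := σ) (by
            rw [lt_div_iff₀ (by positivity)] at hσ
            nlinarith [abs_nonneg σ])
          exact ⟨ψ, hψ, mem_univ _⟩) ht ht'
      refine (integral_congr_ae (Eventually.of_forall fun x => ?_)).trans hint
      simp only [real_inner_smul_right, smul_eq_mul, hd]
    exact fun x => congrFun ((Continuous.ae_eq_iff_eq μ hc continuous_const).1 hae) x
  intro x
  exact sub_eq_zero.1 (inner_self_eq_zero.1 (hzero (d x) x))

end Equations

/-! ### Linearity along geodesics, explicit solutions and conclusion -/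

/-- An ambient geodesic that is tangent to the linear diffeomorphisms at one time stays linear. -/
theorem linear_of_geodesicEquations {γ : ℝ → ConeDiff n} {J : Set ℝ} (hJ : IsOpen J)
    (hJ' : J.OrdConnected)
    (hjoint : ContDiffOn ℝ ∞ (fun q : ℝ × Rn n => (γ q.1).1 q.2) (J ×ˢ univ))
    (h : GeodesicEquations μ γ J) {t₀ : ℝ} (ht₀ : t₀ ∈ J) (h0 : IsLinearMap ℝ (γ t₀).1)
    (hv0 : IsLinearMap ℝ (velocity γ t₀).1) {t : ℝ} (ht : t ∈ J) : IsLinearMap ℝ (γ t).1 := by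
  have hvel : ∀ s ∈ J, ∀ x, (velocity γ s).1 x
      = (((γ s).2 : ℝ)⁻¹ * ((γ t₀).2 : ℝ)) • (velocity γ t₀).1 x := fun s hs x => by
    rw [mul_smul, ← h.momentum s hs t₀ ht₀ x, smul_smul, inv_mul_cancel₀ (γ s).2.2.ne', one_smul]
  -- Applied to the defects of additivity and homogeneity, whose derivatives vanish because every
  -- velocity is a multiple of the linear one at t₀.
  have hconst : ∀ g : ℝ → Rn n, (∀ s ∈ J, HasDerivAt g 0 s) → g t₀ = 0 → g t = 0 :=
    fun g hg hg0 => hg0 ▸ hJ.is_const_of_deriv_eq_zero hJ'.isPreconnected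
      (fun s hs => (hg s hs).differentiableAt.differentiableWithinAt)
      (fun s hs => (hg s hs).deriv) ht ht₀
  refine ⟨fun x y => ?_, fun c x => ?_⟩
  · rw [← sub_eq_zero]
    refine hconst (fun s => (γ s).1 (x + y) - ((γ s).1 x + (γ s).1 y)) (fun s hs => ?_)
      (by simp [h0.map_add])
    refine ((hasDerivAt_apply hJ hjoint hs (x + y)).sub
      ((hasDerivAt_apply hJ hjoint hs x).add (hasDerivAt_apply hJ hjoint hs y))).congr_deriv ?_
    rw [hvel s hs, hvel s hs, hvel s hs, hv0.map_add, smul_add, sub_self]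
  · rw [← sub_eq_zero]
    refine hconst (fun s => (γ s).1 (c • x) - c • (γ s).1 x) (fun s hs => ?_)
      (by simp [h0.map_smul])
    refine ((hasDerivAt_apply hJ hjoint hs (c • x)).sub
      ((hasDerivAt_apply hJ hjoint hs x).const_smul c)).congr_deriv ?_
    rw [hvel s hs, hvel s hs, hv0.map_smul, smul_comm, sub_self]

/-- The explicit geodesic in the linear diffeomorphisms with a given initial velocity. -/
theorem exists_linear_geodesic (hμ : MemLp id 2 μ) (p : ConeDiff n) (hp : IsLinearMap ℝ p.1)
    (v : TangentVec n) (hv : IsLinearMap ℝ v.1) :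
    ∃ δ > 0, ∃ γ : ℝ → ConeDiff n, IsGeodesic μ univ γ (Ioo (-δ) δ) ∧
      (∀ t ∈ Ioo (-δ) δ, IsLinearMap ℝ (γ t).1) ∧ γ 0 = p ∧ velocity γ 0 = v := by
  obtain ⟨A, hA⟩ := exists_clm_of_isLinearMap hp
  obtain ⟨B, hB⟩ := exists_clm_of_isLinearMap hv
  obtain ⟨S, hS⟩ := exists_clm_of_isLinearMap (isLinearMap_symm hp)
  set m₀ : ℝ := (p.2 : ℝ) with hm₀
  have hm₀pos : 0 < m₀ := p.2.2
  set W : Lp (Rn n) 2 μ := (memLp_continuousLinearMap hμ B).toLp B with hW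
  have hWv : W =ᵐ[μ] v.1 := (MemLp.coeFn_toLp _).trans (Eventually.of_forall hB)
  -- With m φ̇ = m₀ v the mass equation reads 2 m m̈ = m₀²‖W‖² + ṁ². A quadratic m with m(0) = m₀
  -- and ṁ(0) = v.2 solves it exactly for this leading coefficient.
  set c : ℝ := (m₀ ^ 2 * inner ℝ W W + v.2 ^ 2) / (4 * m₀) with hc
  set m : ℝ → ℝ := fun t => m₀ + v.2 * t + c * t ^ 2 with hm
  have hmsm : ContDiff ℝ ∞ m := by fun_prop
  have hm0 : m 0 = m₀ := by simp [hm]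
  have hdm : ∀ t, HasDerivAt m (v.2 + 2 * c * t) t := fun t => by
    refine ((((hasDerivAt_id t).const_mul v.2).const_add m₀).add
      (((hasDerivAt_id t).pow 2).const_mul c)).congr_deriv ?_
    simp
    ring
  -- The choice θ' = m₀/m makes the momentum m θ' B = m₀ B constant along A + θ B.
  set θ : ℝ → ℝ := fun t => ∫ s in (0 : ℝ)..t, m₀ / m s with hθ
  have hθ0 : θ 0 = 0 := by simp [hθ]
  obtain ⟨δ₁, hδ₁, hpos⟩ : ∃ δ > 0, ∀ t ∈ Ioo (-δ) δ, 0 < m t := by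
    have h1 : ∀ᶠ t in 𝓝 (0 : ℝ), 0 < m t :=
      hmsm.continuous.continuousAt.eventually (lt_mem_nhds (by rw [hm0]; exact hm₀pos))
    obtain ⟨δ, hδ, h⟩ := Metric.eventually_nhds_iff_ball.1 h1
    exact ⟨δ, hδ, fun t ht => h t (by rwa [Real.ball_eq_Ioo, zero_sub, zero_add])⟩
  have hθd : ∀ t ∈ Ioo (-δ₁) δ₁, HasDerivAt θ (m₀ / m t) t := fun t ht => by
    have h0 : (0 : ℝ) ∈ Ioo (-δ₁) δ₁ := ⟨by linarith, hδ₁⟩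
    have hcont : ContinuousOn (fun s => m₀ / m s) (Ioo (-δ₁) δ₁) :=
      continuousOn_const.div hmsm.continuous.continuousOn fun s hs => (hpos s hs).ne'
    exact intervalIntegral.integral_hasDerivAt_right
      (hcont.mono (ordConnected_Ioo.uIcc_subset h0 ht)).intervalIntegrable
      (hcont.stronglyMeasurableAtFilter isOpen_Ioo t ht) (hcont.continuousAt (isOpen_Ioo.mem_nhds ht))
  have hθsm : ContDiffOn ℝ ∞ θ (Ioo (-δ₁) δ₁) := by
    rw [contDiffOn_infty_iff_deriv_of_isOpen isOpen_Ioo]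
    refine ⟨fun t ht => (hθd t ht).differentiableAt.differentiableWithinAt, ?_⟩
    exact (contDiffOn_const.div hmsm.contDiffOn fun s hs => (hpos s hs).ne').congr
      fun t ht => (hθd t ht).deriv
  have hbound : ∀ x, ‖(fderiv ℝ B x).comp (fderiv ℝ p.1.symm (p.1 x))‖ ≤ ‖B.comp S‖ := fun x => by
    have hS' : (p.1.symm : Rn n → Rn n) = S := funext fun y => (hS y).symm
    rw [hS', S.fderiv, B.fderiv]
  obtain ⟨δ, hδ, hδle, hsmall⟩ : ∃ δ > 0, δ ≤ δ₁ ∧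
      ∀ t ∈ Ioo (-δ) δ, |θ t| * ‖B.comp S‖ < 1 := by
    have hc : ContinuousAt (fun t => |θ t| * ‖B.comp S‖) 0 :=
      ((hθd 0 ⟨by linarith, hδ₁⟩).continuousAt.abs).mul continuousAt_const
    have h1 : ∀ᶠ t in 𝓝 (0 : ℝ), |θ t| * ‖B.comp S‖ < 1 :=
      hc.eventually (gt_mem_nhds (by simp [hθ0]))
    obtain ⟨δ, hδ, h⟩ := Metric.eventually_nhds_iff_ball.1 h1
    refine ⟨min δ δ₁, lt_min hδ hδ₁, min_le_right _ _, fun t ht => h t ?_⟩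
    rw [Real.ball_eq_Ioo, zero_sub, zero_add]
    exact ⟨by linarith [ht.1, min_le_left δ δ₁], by linarith [ht.2, min_le_left δ δ₁]⟩
  have hle : Ioo (-δ) δ ⊆ Ioo (-δ₁) δ₁ := Ioo_subset_Ioo (by linarith) hδle
  have hex : ∀ t ∈ Ioo (-δ) δ, ∃ q : ConeDiff n,
      (∀ x, q.1 x = (A + θ t • B) x) ∧ (q.2 : ℝ) = m t := fun t ht => by
    obtain ⟨ψ, hψ⟩ := exists_diffeo_add_smul p.1 B.contDiff hbound (hsmall t ht)
    exact ⟨(ψ, ⟨m t, hpos t (hle ht)⟩), fun x => by simp [hψ, hA], rfl⟩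
  have : Nonempty (ConeDiff n) := ⟨p⟩
  choose! γ hγ hγm using hex
  have h0 : (0 : ℝ) ∈ Ioo (-δ) δ := ⟨by linarith, hδ⟩
  have hsmooth : SmoothFamily μ γ (Ioo (-δ) δ) :=
    smoothFamily_of_clm hμ (T := fun t => A + θ t • B)
      (contDiffOn_const.add ((hθsm.mono hle).smul contDiffOn_const)) hγ
      (hmsm.contDiffOn.congr hγm)
  have hγe : ∀ t ∈ Ioo (-δ) δ, (fun r => ((γ r).2 : ℝ)) =ᶠ[𝓝 t] m := fun t ht => by
    filter_upwards [isOpen_Ioo.mem_nhds ht] with r hr using hγm r hr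
  have hvel : ∀ t ∈ Ioo (-δ) δ, velocity γ t = ((m₀ / m t) • v.1, v.2 + 2 * c * t) :=
    fun t ht => by
    refine Prod.ext (funext fun x => ?_) (((hdm t).congr_of_eventuallyEq (hγe t ht)).deriv)
    have h1 : HasDerivAt (fun s => A x + θ s • B x) ((m₀ / m t) • B x) t :=
      ((hθd t (hle ht)).smul_const (B x)).const_add (A x)
    refine (hasDerivAt_apply isOpen_Ioo hsmooth.1 ht x).unique ?_
    change HasDerivAt _ ((m₀ / m t) • v.1 x) t
    rw [← hB]
    refine h1.congr_of_eventuallyEq ?_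
    filter_upwards [isOpen_Ioo.mem_nhds ht] with r hr
    simp [hγ r hr x]
  refine ⟨δ, hδ, γ, ?_, fun t ht => ?_, ?_, ?_⟩
  · refine GeodesicEquations.isGeodesic ⟨fun t ht t' ht' x => ?_, fun t ht => ?_⟩ isOpen_Ioo
      ordConnected_Ioo hsmooth fun _ _ => mem_univ _
    · rw [hvel t ht, hvel t' ht', hγm t ht, hγm t' ht']
      simp only [Pi.smul_apply, smul_smul]
      rw [mul_div_cancel₀ _ (hpos t (hle ht)).ne', mul_div_cancel₀ _ (hpos t' (hle ht')).ne']
    · have hd : deriv (deriv fun r => ((γ r).2 : ℝ)) t = 2 * c := by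
        rw [Filter.EventuallyEq.deriv_eq (f := fun r => v.2 + 2 * c * r) (by
          filter_upwards [isOpen_Ioo.mem_nhds ht] with r hr
          rw [(hγe r hr).deriv_eq, (hdm r).deriv])]
        simp
      have hWt : ((m₀ / m t) • W : Lp (Rn n) 2 μ) =ᵐ[μ] (velocity γ t).1 := by
        rw [hvel t ht]
        filter_upwards [Lp.coeFn_smul (m₀ / m t) W, hWv] with x h1 h2
        rw [h1, Pi.smul_apply, Pi.smul_apply, h2]
      rw [hd, uotMetric_eq_inner hWt hWt, hvel t ht, hγm t ht, real_inner_smul_left,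
        real_inner_smul_right]
      have hmt := (hpos t (hle ht)).ne'
      have hmt' : m t = m₀ + v.2 * t + c * t ^ 2 := rfl
      have hc' : m₀ ^ 2 * inner ℝ W W = c * (4 * m₀) - v.2 ^ 2 := by
        rw [hc]
        field_simp
        ring
      have key : m t * (m₀ / m t * (m₀ / m t * inner ℝ W W)) = m₀ ^ 2 * inner ℝ W W / m t := by
        field_simp
      rw [key, hc', ← add_div, eq_comm, mul_div_assoc', div_eq_iff hmt, hmt']
      ring
  · have heq : ((γ t).1 : Rn n → Rn n) = (A + θ t • B : Rn n →L[ℝ] Rn n) := funext (hγ t ht)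
    rw [heq]
    exact (A + θ t • B).toLinearMap.isLinear
  · refine Prod.ext (Diffeomorph.ext fun x => ?_) (Subtype.ext ?_)
    · rw [hγ 0 h0 x, hθ0]
      simp [hA]
    · rw [hγm 0 h0, hm0]
  · rw [hvel 0 h0, hm0, div_self hm₀pos.ne']
    simp

lemma isLinearMap_of_mem_tangentVectors {p : ConeDiff n} {v : TangentVec n}
    (hv : v ∈ tangentVectors μ (range (inclusion (n := n))) p) : IsLinearMap ℝ v.1 := by
  obtain ⟨δ, hδ, c, hc, hcN, -, rfl⟩ := hv
  exact isLinearMap_velocity isOpen_Ioo hc.1 (fun t ht => mem_range_inclusion_iff.1 (hcN t ht))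
    ⟨by linarith, hδ⟩

theorem isTotallyGeodesic_range_inclusion [IsFiniteMeasure μ] [μ.IsOpenPosMeasure]
    (hμ : MemLp id 2 μ) : IsTotallyGeodesic μ (range (inclusion (n := n))) where
  ambient_geodesic γ J hJ hJ' hγ :=
    (geodesicEquations_of_linear hμ hJ hJ' hγ).isGeodesic hJ hJ' hγ.smooth fun _ _ => mem_univ _
  stays γ J hJ hJ' hγ t₀ ht₀ h0 hv t ht :=
    mem_range_inclusion_iff.2 (linear_of_geodesicEquations hJ hJ' hγ.smooth.1
      (geodesicEquations_of_ambient hJ hJ' hγ) ht₀ (mem_range_inclusion_iff.1 h0)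
      (isLinearMap_of_mem_tangentVectors hv) ht)
  exists_geodesic p hp v hv := by
    obtain ⟨δ, hδ, γ, hγ, hlin, h0, h1⟩ := exists_linear_geodesic hμ p
      (mem_range_inclusion_iff.1 hp) v (isLinearMap_of_mem_tangentVectors hv)
    exact ⟨δ, hδ, γ, hγ, fun t ht => mem_range_inclusion_iff.2 (hlin t ht), h0, h1⟩

end ConeUOT

end

theorem mainTheorem5 (n : ℕ) (S : Matrix (Fin n) (Fin n) ℝ) (hS : S.PosDef) :
    ConeUOT.InclusionIsSubmanifold (multivariateGaussian (0 : ConeUOT.Rn n) S) ∧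
    ConeUOT.IsTotallyGeodesic (multivariateGaussian (0 : ConeUOT.Rn n) S)
      (Set.range (ConeUOT.inclusion (n := n))) := by
  have := ConeUOT.isOpenPosMeasure_multivariateGaussian (0 : ConeUOT.Rn n) hS
  have hμ : MemLp id 2 (multivariateGaussian (0 : ConeUOT.Rn n) S) := IsGaussian.memLp_two_id
  exact ⟨ConeUOT.inclusionIsSubmanifold hμ, ConeUOT.isTotallyGeodesic_range_inclusion hμ⟩
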